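/- **Proposition (Orbifold Bohr--Sommerfeld condition).** Let $X$ be a paracompact Hausdorff smooth effective orbifold of dimension $2n$ (boundaryless, no global quotient presentation assumed), given by an atlas of charts $(V,G,\pi)$, where $V\subset\mathbb R^{2n}$ is open and connected, $G$ is a finite group acting smoothly and effectively on $V$, and $\pi$ induces a homeomorphism of $V/G$ onto an open subset of $X$. Let $\omega$ be an orbifold symplectic form on $X$, and let $P$ be a real orbifold polarization: on each chart an involutive Lagrangian complex subbundle $P_V\subset TV\otimes\mathbb C$ of rank $n$, compatible with all chart embeddings and local group actions, with $P=\overline P$; write $P_{\mathbb R}=P\cap TX$. Let $\hbar>0$ and let $(L,\nabla)$ be a prequantum line bundle: a Hermitian orbifold line bundle with unitary orbifold connection and curvature $F_\nabla=-\frac{i}{\hbar}\omega$. For $g\in G$ let $\Phi_g\colon (L_V)_x\to (L_V)_{gx}$ denote the equivariant lift. A *leafwise path* in $V$ is a path that is continuous in the leaf topology of the foliation of $V$ by the integral manifolds of $P_{\mathbb R}$. A *leafwise orbifold path* is a finite concatenation of leafwise paths in charts and of transitions along chart embeddings and their inverses (including the elements of the local groups); it is an orbifold loop if it returns to its initial point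 in the initial chart. A *leaf* $\mathcal L\subset X$ of $P$ is the set of all points of $X$ that can be reached from a given point along leafwise orbifold paths. Since $\omega$ vanishes on $P_{\mathbb R}$, $\nabla$ is flat along the leaves; $\mathrm{Par}_{\tilde\gamma}$ denotes parallel transport of this flat connection along a leafwise path $\tilde\gamma$, and the *orbifold holonomy* of a leafwise orbifold loop is the composite of the parallel transports along its lifted pieces and the bundle identifications over its transitions. The leaf $\mathcal L$ is *Bohr--Sommerfeld* if $L|_{\mathcal L}$ has a non-zero smooth orbifold section (compatible with all chart embeddings and local group actions) that is covariantly constant along $\mathcal L$. Let $\mathcal L$ be a leaf of $P$. Then: 1. For every leafwise path $\tilde\gamma\colon[0,1]\to V$ in a chart, parallel transport exists and is unique, and $\mathrm{Par}_{\tilde\gamma}\colon (L_V)_{\tilde\gamma(0)}\to (L_V)_{\tilde\gamma(1)}$ is a $\mathbb C$-linear isometry. 2. $\mathcal L$ is Bohr--Sommerfeld if and only if the orbifold holonomy of $L|_{\mathcal L}$ is the identity for every leafwise orbifold loop in $\mathcal L$. 3. For an orbifold loop represented in a single chart $(V,G,\pi)$ by a leafwise path $\tilde\gamma$ with $\tilde\gamma(1)=g\cdot\tilde\gamma(0)$,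 $g\in G$, triviality of the holonomy is the condition $$\Phi_{g^{-1}}\circ\mathrm{Par}_{\tilde\gamma}=\mathrm{Id}\quad\text{on }(L_V)_{\tilde\gamma(0)}.$$ -/

import Mathlib

open scoped ContDiff Topology

universe u v w

noncomputable section

/-! ### Effective orbifolds -/

/-- The model space `ℝᵐ`. -/
abbrev RSpace (m : ℕ) : Type := EuclideanSpace ℝ (Fin m)

/-- Its complexification `ℂᵐ = ℝᵐ ⊗ ℂ`. -/
abbrev CSpace (m : ℕ) : Type := EuclideanSpace ℂ (Fin m)

/-- An (effective, smooth) orbifold chart `(V, G, π)` of dimension `m` on `X`: a nonempty connected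
open set `V ⊆ ℝᵐ`, a finite group `G` acting smoothly and effectively on `V`, and a map `π` on `V`
which is continuous and open onto an open subset of `X` and whose fibres are the `G`-orbits, that
is, `π` induces a homeomorphism of `V / G` onto an open subset of `X`. (The functions `act g` and
`proj` are only used on `V`.) -/
structure OrbifoldChart (m : ℕ) (X : Type u) [TopologicalSpace X] where
  V : Set (RSpace m)
  isOpen_V : IsOpen V
  isConnected_V : IsConnected V
  G : Type v
  [group : Group G]
  [finite : Finite G]
  act : G → RSpace m → RSpace m
  act_mem : ∀ g, Set.MapsTo (act g) V V
  act_one : ∀ x ∈ V, act 1 x = x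
  act_mul : ∀ g h, ∀ x ∈ V, act (g * h) x = act g (act h x)
  act_smooth : ∀ g, ContDiffOn ℝ ∞ (act g) V
  act_effective : ∀ g, (∀ x ∈ V, act g x = x) → g = 1
  proj : RSpace m → X
  proj_continuousOn : ContinuousOn proj V
  proj_open : ∀ O ⊆ V, IsOpen O → IsOpen (proj '' O)
  proj_eq_iff : ∀ x ∈ V, ∀ y ∈ V, proj x = proj y ↔ ∃ g, act g x = y

attribute [instance] OrbifoldChart.group OrbifoldChart.finite

namespace OrbifoldChart

variable {m : ℕ} {X : Type*} [TopologicalSpace X]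

/-- The open subset of `X` uniformized by the chart. -/
def U (C : OrbifoldChart m X) : Set X := C.proj '' C.V

theorem act_inv_act (C : OrbifoldChart m X) (g : C.G) {x : RSpace m} (hx : x ∈ C.V) :
    C.act g⁻¹ (C.act g x) = x := by
  rw [← C.act_mul _ _ x hx, inv_mul_cancel, C.act_one x hx]

theorem act_inv_eq (C : OrbifoldChart m X) (g : C.G) {x y : RSpace m} (hx : x ∈ C.V)
    (h : C.act g x = y) : C.act g⁻¹ y = x := by
  rw [← h, C.act_inv_act g hx]

/-- A chart embedding: a smooth open embedding `V → V'` over `X` (by equality of dimensions, an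
injective smooth map with injective differentials), equivariant along an injective group
homomorphism. -/
structure Embedding (C D : OrbifoldChart m X) where
  toFun : RSpace m → RSpace m
  mapsTo : Set.MapsTo toFun C.V D.V
  smooth : ContDiffOn ℝ ∞ toFun C.V
  injOn : Set.InjOn toFun C.V
  immersion : ∀ x ∈ C.V, Function.Injective (fderiv ℝ toFun x)
  hom : C.G →* D.G
  hom_injective : Function.Injective hom
  equivariant : ∀ g, ∀ x ∈ C.V, toFun (C.act g x) = D.act (hom g) (toFun x)
  proj_comp : ∀ x ∈ C.V, D.proj (toFun x) = C.proj x

/-- An element `g` of the local group, viewed as an embedding of the chart into itself (equivariant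
along conjugation by `g`). -/
def autEmb (C : OrbifoldChart m X) (g : C.G) : Embedding C C where
  toFun := C.act g
  mapsTo := C.act_mem g
  smooth := C.act_smooth g
  injOn := fun x hx y hy h => by
    rw [← C.act_inv_act g hx, ← C.act_inv_act g hy, h]
  immersion := fun x hx => by
    have hd : ∀ (k : C.G) (y : RSpace m), y ∈ C.V → DifferentiableAt ℝ (C.act k) y := fun k y hy =>
      ((C.act_smooth k).contDiffAt (C.isOpen_V.mem_nhds hy)).differentiableAt (by simp)
    have h1 : fderiv ℝ (C.act g⁻¹ ∘ C.act g) x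
        = (fderiv ℝ (C.act g⁻¹) (C.act g x)).comp (fderiv ℝ (C.act g) x) :=
      fderiv_comp x (hd _ _ (C.act_mem g hx)) (hd _ _ hx)
    have h2 : fderiv ℝ (C.act g⁻¹ ∘ C.act g) x = ContinuousLinearMap.id ℝ _ := by
      rw [← fderiv_id (𝕜 := ℝ) (x := x)]
      apply Filter.EventuallyEq.fderiv_eq
      filter_upwards [C.isOpen_V.mem_nhds hx] with y hy
      exact C.act_inv_act g hy
    intro v w hvw
    have h3 := fun u => congrArg (fun T : RSpace m →L[ℝ] RSpace m => T u) (h1.symm.trans h2)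
    have hv := h3 v
    have hw := h3 w
    simp only [ContinuousLinearMap.comp_apply, ContinuousLinearMap.id_apply] at hv hw
    rw [← hv, ← hw, hvw]
  hom := (MulAut.conj g).toMonoidHom
  hom_injective := (MulAut.conj g).injective
  equivariant := fun h x hx => by
    have e : ∀ (k l : C.G), C.act k (C.act l x) = C.act (k * l) x :=
      fun k l => (C.act_mul k l x hx).symm
    simp only [MulEquiv.coe_toMonoidHom, MulAut.conj_apply, e]
    congr 1
    group
  proj_comp := fun x hx =>
    ((C.proj_eq_iff x hx _ (C.act_mem g hx)).2 ⟨g, rfl⟩).symm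

end OrbifoldChart

/-- An orbifold atlas of dimension `m` on `X`: charts covering `X` such that every point of an
overlap lies in a smaller chart of the atlas which embeds into both. -/
structure OrbifoldAtlas (m : ℕ) (X : Type u) [TopologicalSpace X] where
  Idx : Type w
  chart : Idx → OrbifoldChart.{u, v} m X
  cover : ∀ p : X, ∃ i, p ∈ (chart i).U
  compat : ∀ i j, ∀ p ∈ (chart i).U ∩ (chart j).U, ∃ k, p ∈ (chart k).U ∧
    (chart k).U ⊆ (chart i).U ∩ (chart j).U ∧
    Nonempty ((chart k).Embedding (chart i)) ∧ Nonempty ((chart k).Embedding (chart j))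

namespace OrbifoldAtlas

variable {m : ℕ} {X : Type*} [TopologicalSpace X]

/-- The uniformizing space of the `i`-th chart. -/
abbrev V (A : OrbifoldAtlas m X) (i : A.Idx) : Set (RSpace m) := (A.chart i).V

/-- Embeddings of the `k`-th chart into the `i`-th chart. -/
abbrev Emb (A : OrbifoldAtlas m X) (k i : A.Idx) := (A.chart k).Embedding (A.chart i)

/-- Points of the disjoint union of the uniformizing spaces. -/
abbrev Pt (A : OrbifoldAtlas m X) := Σ i : A.Idx, A.V i

/-- The point of `X` below a point of a uniformizing space. -/
def proj (A : OrbifoldAtlas m X) (p : A.Pt) : X := (A.chart p.1).proj p.2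

end OrbifoldAtlas

/-! ### Symplectic forms -/

/-- An orbifold symplectic form: closed nondegenerate smooth `2`-forms on the uniformizing spaces,
preserved by all chart embeddings (in particular by the local groups, see `autEmb`). -/
structure OrbifoldSymplecticForm {m : ℕ} {X : Type*} [TopologicalSpace X]
    (A : OrbifoldAtlas m X) where
  form : A.Idx → RSpace m → RSpace m [⋀^Fin 2]→L[ℝ] ℝ
  smooth : ∀ i, ContDiffOn ℝ ∞ (form i) (A.V i)
  compat : ∀ k i (e : A.Emb k i), ∀ x ∈ A.V k,
    (form i (e.toFun x)).compContinuousLinearMap (fderiv ℝ e.toFun x) = form k x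
  closed : ∀ i, ∀ x ∈ A.V i, extDeriv (form i) x = 0
  nondegenerate : ∀ i, ∀ x ∈ A.V i, ∀ u, (∀ v, form i x ![u, v] = 0) → u = 0

/-! ### Complexified tangent vectors -/

section Complexification

variable {m : ℕ}

/-- Real part of a complexified vector. -/
def reVec (z : CSpace m) : RSpace m := WithLp.toLp 2 fun j => (z j).re

/-- Imaginary part of a complexified vector. -/
def imVec (z : CSpace m) : RSpace m := WithLp.toLp 2 fun j => (z j).im

/-- The complexified vector `u + i v`. -/
def ofReIm (u v : RSpace m) : CSpace m := WithLp.toLp 2 fun j => ⟨u j, v j⟩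

/-- Complex conjugation. -/
def conjVec (z : CSpace m) : CSpace m := ofReIm (reVec z) (-imVec z)

/-- Complex-linear extension of a real linear map. -/
def complexifyMap (T : RSpace m →L[ℝ] RSpace m) (z : CSpace m) : CSpace m :=
  ofReIm (T (reVec z)) (T (imVec z))

/-- Complex-bilinear extension of a real `2`-form. -/
def complexifyForm (Ω : RSpace m [⋀^Fin 2]→L[ℝ] ℝ) (z w : CSpace m) : ℂ :=
  ⟨Ω ![reVec z, reVec w] - Ω ![imVec z, imVec w], Ω ![reVec z, imVec w] + Ω ![imVec z, reVec w]⟩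

/-- Complex-bilinear extension of the Lie bracket of vector fields. -/
def complexLieBracket (ξ η : RSpace m → CSpace m) (x : RSpace m) : CSpace m :=
  let a : RSpace m → RSpace m := fun y => reVec (ξ y)
  let b : RSpace m → RSpace m := fun y => imVec (ξ y)
  let c : RSpace m → RSpace m := fun y => reVec (η y)
  let d : RSpace m → RSpace m := fun y => imVec (η y)
  ofReIm (VectorField.lieBracket ℝ a c x - VectorField.lieBracket ℝ b d x)
    (VectorField.lieBracket ℝ a d x + VectorField.lieBracket ℝ b c x)

end Complexification

/-! ### Polarizations -/

/-- An orbifold polarization: a smooth complex subbundle of the complexified tangent bundle of each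
uniformizing space, of rank `n`, preserved by all chart embeddings (in particular by the local
groups), Lagrangian and involutive. -/
structure OrbifoldPolarization {n : ℕ} {X : Type*} [TopologicalSpace X]
    {A : OrbifoldAtlas (2 * n) X} (Ω : OrbifoldSymplecticForm A) where
  sub : A.Idx → RSpace (2 * n) → Submodule ℂ (CSpace (2 * n))
  finrank_eq : ∀ i, ∀ x ∈ A.V i, Module.finrank ℂ (sub i x) = n
  smooth : ∀ i, ∀ x ∈ A.V i, ∃ O : Set (RSpace (2 * n)), IsOpen O ∧ x ∈ O ∧ O ⊆ A.V i ∧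
    ∃ ξ : Fin n → RSpace (2 * n) → CSpace (2 * n), (∀ j, ContDiffOn ℝ ∞ (ξ j) O) ∧
      ∀ y ∈ O, sub i y = Submodule.span ℂ (Set.range fun j => ξ j y)
  compat : ∀ k i (e : A.Emb k i), ∀ x ∈ A.V k,
    (sub i (e.toFun x) : Set (CSpace (2 * n))) = complexifyMap (fderiv ℝ e.toFun x) '' sub k x
  lagrangian : ∀ i, ∀ x ∈ A.V i, ∀ z ∈ sub i x, ∀ w ∈ sub i x,
    complexifyForm (Ω.form i x) z w = 0
  involutive : ∀ i, ∀ O : Set (RSpace (2 * n)), IsOpen O → O ⊆ A.V i →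
    ∀ ξ η : RSpace (2 * n) → CSpace (2 * n), ContDiffOn ℝ ∞ ξ O → ContDiffOn ℝ ∞ η O →
      (∀ x ∈ O, ξ x ∈ sub i x) → (∀ x ∈ O, η x ∈ sub i x) →
      ∀ x ∈ O, complexLieBracket ξ η x ∈ sub i x

/-! ### Leaves and leafwise orbifold paths -/

namespace OrbifoldPolarization

variable {n : ℕ} {X : Type*} [TopologicalSpace X] {A : OrbifoldAtlas (2 * n) X}
  {Ω : OrbifoldSymplecticForm A}

/-- The polarization is real: it equals its complex conjugate. -/
def IsReal (P : OrbifoldPolarization Ω) : Prop :=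
  ∀ i, ∀ x ∈ A.V i, ∀ z ∈ P.sub i x, conjVec z ∈ P.sub i x

/-- The real distribution whose complexification is a real polarization. -/
def realPart (P : OrbifoldPolarization Ω) (i : A.Idx) (x : RSpace (2 * n)) :
    Set (RSpace (2 * n)) :=
  {v | ofReIm v 0 ∈ P.sub i x}

/-- A parametrized integral manifold of the real distribution in a uniformizing space: a smooth map
from an open subset of `ℝⁿ` whose differentials have the real distribution as range (hence, when the
polarization is real, an immersion). These maps are the local inverse charts of the lifted leaves. -/
structure Plaque (P : OrbifoldPolarization Ω) (i : A.Idx) where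
  dom : Set (RSpace n)
  isOpen_dom : IsOpen dom
  toFun : RSpace n → RSpace (2 * n)
  smooth : ContDiffOn ℝ ∞ toFun dom
  mapsTo : Set.MapsTo toFun dom (A.V i)
  range_fderiv : ∀ w ∈ dom, Set.range (fderiv ℝ toFun w) = P.realPart i (toFun w)

/-- The point of the uniformizing space with parameter `w`. -/
def Plaque.pt {P : OrbifoldPolarization Ω} {i : A.Idx} (Q : P.Plaque i) (w : RSpace n)
    (hw : w ∈ Q.dom) : A.V i :=
  ⟨Q.toFun w, Q.mapsTo hw⟩

/-- A path `[0,1] → V` which is a continuous path in a lifted leaf for the leaf topology: locally it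
is the image of a continuous path in the parameter domain of an integral manifold. -/
structure LeafSegment (P : OrbifoldPolarization Ω) (i : A.Idx) where
  toFun : unitInterval → A.V i
  leafwise : ∀ t, ∃ (Q : P.Plaque i) (c : unitInterval → RSpace n), ∃ N ∈ 𝓝 t,
    ContinuousOn c N ∧ Set.MapsTo c N Q.dom ∧ ∀ s ∈ N, (toFun s : RSpace (2 * n)) = Q.toFun (c s)

/-- Leafwise orbifold paths: finite concatenations of leafwise lifted paths in the uniformizing
spaces and of transitions between charts along chart embeddings and their inverses (in particular
along elements of the local groups, including the return element of a loop). -/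
inductive LeafPath (P : OrbifoldPolarization Ω) : A.Pt → A.Pt → Type _
  | refl (p : A.Pt) : LeafPath P p p
  | segment {i : A.Idx} (γ : P.LeafSegment i) : LeafPath P ⟨i, γ.toFun 0⟩ ⟨i, γ.toFun 1⟩
  | jump {k i : A.Idx} (e : A.Emb k i) (x : A.V k) (y : A.V i)
      (h : e.toFun x = (y : RSpace (2 * n))) : LeafPath P ⟨k, x⟩ ⟨i, y⟩
  | jumpInv {k i : A.Idx} (e : A.Emb k i) (x : A.V k) (y : A.V i)
      (h : e.toFun x = (y : RSpace (2 * n))) : LeafPath P ⟨i, y⟩ ⟨k, x⟩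
  | trans {p q r : A.Pt} : LeafPath P p q → LeafPath P q r → LeafPath P p r

/-- The loop in a single chart represented by a leafwise path `γ` with `γ 1 = g • γ 0`: run along
`γ`, then return along `g⁻¹`. -/
def chartLoop (P : OrbifoldPolarization Ω) {i : A.Idx} (γ : P.LeafSegment i)
    (g : (A.chart i).G) (h : (A.chart i).act g (γ.toFun 0) = γ.toFun 1) :
    P.LeafPath ⟨i, γ.toFun 0⟩ ⟨i, γ.toFun 0⟩ :=
  .trans (.segment γ)
    (.jump ((A.chart i).autEmb g⁻¹) (γ.toFun 1) (γ.toFun 0)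
      ((A.chart i).act_inv_eq g (γ.toFun 0).2 h))

/-- A leaf in `X`: all points reachable from a given point along leafwise orbifold paths. -/
def IsLeaf (P : OrbifoldPolarization Ω) (Λ : Set X) : Prop :=
  ∃ p : A.Pt, Λ = {x | ∃ q : A.Pt, A.proj q = x ∧ Nonempty (P.LeafPath p q)}

end OrbifoldPolarization

/-! ### Prequantum line bundles -/

/-- A Hermitian orbifold line bundle: over each uniformizing space a family of Hermitian complex
lines together with an open cover by local unitary frames, and over each chart embedding an isometric
bundle map `trans`, compatibly with composition, and smooth in the given frames. Taking the
embeddings `autEmb g` one gets the equivariant structure of the local groups, and for `g = 1`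
smoothness is that of the change of frames within a chart. -/
structure OrbifoldLineBundle {m : ℕ} {X : Type*} [TopologicalSpace X]
    (A : OrbifoldAtlas m X) where
  fiber : A.Pt → Type*
  [normed : ∀ p, NormedAddCommGroup (fiber p)]
  [inner : ∀ p, InnerProductSpace ℂ (fiber p)]
  finrank_eq : ∀ p, Module.finrank ℂ (fiber p) = 1
  Frame : A.Idx → Type*
  O : ∀ i, Frame i → Set (RSpace m)
  isOpen_O : ∀ i a, IsOpen (O i a)
  O_subset : ∀ i a, O i a ⊆ A.V i
  O_cover : ∀ i, ∀ x ∈ A.V i, ∃ a, x ∈ O i a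
  frame : ∀ i, Frame i → ∀ x : A.V i, fiber ⟨i, x⟩
  norm_frame : ∀ i a (x : A.V i), (x : RSpace m) ∈ O i a → ‖frame i a x‖ = 1
  trans : ∀ {k i} (e : A.Emb k i) (x : A.V k) (y : A.V i), e.toFun x = (y : RSpace m) →
    (fiber ⟨k, x⟩ ≃ₗᵢ[ℂ] fiber ⟨i, y⟩)
  trans_comp : ∀ {k i j} (e : A.Emb k i) (e' : A.Emb i j) (e'' : A.Emb k j),
    (∀ x ∈ A.V k, e''.toFun x = e'.toFun (e.toFun x)) →
    ∀ (x : A.V k) (y : A.V i) (z : A.V j) (hxy : e.toFun x = (y : RSpace m))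
      (hyz : e'.toFun y = (z : RSpace m)) (hxz : e''.toFun x = (z : RSpace m)) v,
      trans e'' x z hxz v = trans e' y z hyz (trans e x y hxy v)
  trans_smooth : ∀ {k i} (e : A.Emb k i) (a : Frame k) (b : Frame i), ∃ h : RSpace m → ℂ,
    ContDiffOn ℝ ∞ h (O k a ∩ e.toFun ⁻¹' O i b) ∧
    ∀ (x : A.V k) (y : A.V i) (hxy : e.toFun x = (y : RSpace m)),
      (x : RSpace m) ∈ O k a → (y : RSpace m) ∈ O i b →
      trans e x y hxy (frame k a x) = h x • frame i b y

attribute [instance] OrbifoldLineBundle.normed OrbifoldLineBundle.inner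

namespace OrbifoldLineBundle

variable {m : ℕ} {X : Type*} [TopologicalSpace X] {A : OrbifoldAtlas m X}

/-- The equivariant lift `Φ_g : L_x → L_{g x}` of an element of the local group. -/
def Φ (L : OrbifoldLineBundle A) {i : A.Idx} (g : (A.chart i).G) (x y : A.V i)
    (h : (A.chart i).act g x = (y : RSpace m)) : L.fiber ⟨i, x⟩ ≃ₗᵢ[ℂ] L.fiber ⟨i, y⟩ :=
  L.trans ((A.chart i).autEmb g) x y h

/-- A unitary connection, given in each local unitary frame `s` by a real `1`-form `A` with
`∇ (u s) = (du - i u A) s`. If a bundle map over an embedding `e` takes `s` to `h t`, the forms `A`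
and `B` of `s` and `t` satisfy `dh = - i (A - e^* B) h`: the bundle map preserves the connections
(for the identity embedding this is the gauge transformation law within a chart). -/
structure UnitaryConnection (L : OrbifoldLineBundle A) where
  pot : ∀ i, L.Frame i → RSpace m → RSpace m [⋀^Fin 1]→L[ℝ] ℝ
  smooth : ∀ i a, ContDiffOn ℝ ∞ (pot i a) (L.O i a)
  compat : ∀ {k i} (e : A.Emb k i) (a : L.Frame k) (b : L.Frame i) (h : RSpace m → ℂ),
    ContDiffOn ℝ ∞ h (L.O k a ∩ e.toFun ⁻¹' L.O i b) →
    (∀ (x : A.V k) (y : A.V i) (hxy : e.toFun x = (y : RSpace m)),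
      (x : RSpace m) ∈ L.O k a → (y : RSpace m) ∈ L.O i b →
      L.trans e x y hxy (L.frame k a x) = h x • L.frame i b y) →
    ∀ x ∈ L.O k a ∩ e.toFun ⁻¹' L.O i b, ∀ v : RSpace m,
      fderiv ℝ h x v = -Complex.I *
        ((pot k a x ![v] - pot i b (e.toFun x) ![fderiv ℝ e.toFun x v] : ℝ) : ℂ) * h x

/-- The prequantization condition `F = - (i / ħ) Ω` for the curvature `F = - i dA`. -/
def UnitaryConnection.IsPrequantum {L : OrbifoldLineBundle A} (D : L.UnitaryConnection)
    (Ω : OrbifoldSymplecticForm A) (hbar : ℝ) : Prop :=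
  ∀ i a, ∀ x ∈ L.O i a, extDeriv (D.pot i a) x = hbar⁻¹ • Ω.form i x

end OrbifoldLineBundle

/-! ### Leafwise parallel transport, holonomy, and parallel sections -/

namespace OrbifoldLineBundle

variable {n : ℕ} {X : Type*} [TopologicalSpace X] {A : OrbifoldAtlas (2 * n) X}
  {Ω : OrbifoldSymplecticForm A} {L : OrbifoldLineBundle A} (P : OrbifoldPolarization Ω)

/-- The section `u s` along the integral manifold `Q`, where `s` is a local frame whose domain
contains `Q`, is smooth. -/
def IsSmoothCoeff {P : OrbifoldPolarization Ω} {i : A.Idx} (Q : P.Plaque i) (u : RSpace n → ℂ) :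
    Prop :=
  ContDiffOn ℝ ∞ u Q.dom

/-- The section `u s` along the integral manifold `Q`, where `s` is a local frame whose domain
contains `Q`, is covariantly constant: `du - i u A = 0` along `Q`. -/
def UnitaryConnection.IsFlatCoeff {P : OrbifoldPolarization Ω} (D : L.UnitaryConnection)
    {i : A.Idx} (Q : P.Plaque i) (a : L.Frame i) (u : RSpace n → ℂ) : Prop :=
  ∀ w ∈ Q.dom, ∀ v : RSpace n,
    fderiv ℝ u w v - Complex.I * (D.pot i a (Q.toFun w) ![fderiv ℝ Q.toFun w v] : ℂ) * u w = 0

/-- `σ` is a parallel lift of the leafwise path `γ` for the flat leafwise connection: locally it is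
the restriction to `γ` of a smooth covariantly constant section along an integral manifold. -/
def UnitaryConnection.IsParallelLift {P : OrbifoldPolarization Ω} (D : L.UnitaryConnection)
    {i : A.Idx} (γ : P.LeafSegment i) (σ : ∀ t, L.fiber ⟨i, γ.toFun t⟩) : Prop :=
  ∀ t, ∃ (Q : P.Plaque i) (a : L.Frame i) (u : RSpace n → ℂ) (c : unitInterval → RSpace n),
    Set.MapsTo Q.toFun Q.dom (L.O i a) ∧ IsSmoothCoeff Q u ∧ D.IsFlatCoeff Q a u ∧
    ∃ N ∈ 𝓝 t, ContinuousOn c N ∧ Set.MapsTo c N Q.dom ∧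
      ∀ s ∈ N, (γ.toFun s : RSpace (2 * n)) = Q.toFun (c s) ∧
        σ s = u (c s) • L.frame i a (γ.toFun s)

/-- The vector `w` at the end of `γ` is obtained from `v` at its start by parallel transport. -/
def UnitaryConnection.IsTransport {P : OrbifoldPolarization Ω} (D : L.UnitaryConnection)
    {i : A.Idx} (γ : P.LeafSegment i) (v : L.fiber ⟨i, γ.toFun 0⟩)
    (w : L.fiber ⟨i, γ.toFun 1⟩) : Prop :=
  ∃ σ : ∀ t, L.fiber ⟨i, γ.toFun t⟩, D.IsParallelLift γ σ ∧ σ 0 = v ∧ σ 1 = w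

/-- Parallel transport `Par_γ` along a leafwise path in a uniformizing space. -/
def UnitaryConnection.par {P : OrbifoldPolarization Ω} (D : L.UnitaryConnection)
    {i : A.Idx} (γ : P.LeafSegment i) (v : L.fiber ⟨i, γ.toFun 0⟩) : L.fiber ⟨i, γ.toFun 1⟩ :=
  Classical.epsilon (D.IsTransport γ v)

/-- Transport along a leafwise orbifold path: parallel transport along the lifted paths, composed
with the bundle maps over the transitions. For a loop this is its orbifold holonomy. -/
def UnitaryConnection.hol {P : OrbifoldPolarization Ω} (D : L.UnitaryConnection) {p q : A.Pt}
    (ℓ : P.LeafPath p q) : L.fiber p → L.fiber q :=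
  match ℓ with
  | .refl _ => id
  | .segment γ => D.par γ
  | .jump e x y h => L.trans e x y h
  | .jumpInv e x y h => (L.trans e x y h).symm
  | .trans ℓ₁ ℓ₂ => D.hol ℓ₂ ∘ D.hol ℓ₁

/-- A smooth orbifold section of `L` along the leaf `Λ`: values at all points over `Λ`, compatible
with all chart embeddings (in particular equivariant under the local groups), and smooth along the
integral manifolds contained in the leaf. -/
structure LeafSection (L : OrbifoldLineBundle A) (P : OrbifoldPolarization Ω) (Λ : Set X) where
  val : ∀ p : A.Pt, A.proj p ∈ Λ → L.fiber p
  equivariant : ∀ {k i} (e : A.Emb k i) (x : A.V k) (y : A.V i)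
    (h : e.toFun x = (y : RSpace (2 * n))) (hx : A.proj ⟨k, x⟩ ∈ Λ) (hy : A.proj ⟨i, y⟩ ∈ Λ),
    L.trans e x y h (val ⟨k, x⟩ hx) = val ⟨i, y⟩ hy
  smooth : ∀ {i} (Q : P.Plaque i) (hQ : ∀ w hw, A.proj ⟨i, Q.pt w hw⟩ ∈ Λ) (a : L.Frame i),
    Set.MapsTo Q.toFun Q.dom (L.O i a) → ∃ u : RSpace n → ℂ, IsSmoothCoeff Q u ∧
      ∀ w hw, val ⟨i, Q.pt w hw⟩ (hQ w hw) = u w • L.frame i a (Q.pt w hw)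

/-- The section is covariantly constant along the leaf. -/
def UnitaryConnection.IsCovariantlyConstant {P : OrbifoldPolarization Ω}
    (D : L.UnitaryConnection) {Λ : Set X} (s : LeafSection L P Λ) : Prop :=
  ∀ {i} (Q : P.Plaque i) (hQ : ∀ w hw, A.proj ⟨i, Q.pt w hw⟩ ∈ Λ) (a : L.Frame i)
    (u : RSpace n → ℂ), Set.MapsTo Q.toFun Q.dom (L.O i a) → IsSmoothCoeff Q u →
    (∀ w hw, s.val ⟨i, Q.pt w hw⟩ (hQ w hw) = u w • L.frame i a (Q.pt w hw)) →
    D.IsFlatCoeff Q a u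

/-- The leaf `Λ` is Bohr-Sommerfeld: there is a non-zero covariantly constant orbifold section of
`L` along `Λ`. -/
def UnitaryConnection.IsBohrSommerfeld (D : L.UnitaryConnection) (Λ : Set X) : Prop :=
  ∃ s : LeafSection L P Λ, D.IsCovariantlyConstant s ∧ ∃ p hp, s.val p hp ≠ 0

end OrbifoldLineBundle

end

/-! A parallel lift is defined locally, as the restriction to the path of a smooth flat section
along some integral manifold. The manifold and the frame may change from one parameter to the next,
so the analytic work is to show that these choices do not matter.

Uniqueness. Near a point, a real polarization consists of graphs of a smooth slope field over a
linear projection `p` to `ℝⁿ`. Integral manifolds through the point are then graphs over `ℝⁿ` whose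
restrictions to rays solve one Lipschitz ODE, so any two coincide near it (`adapted_eq`). On this
common graph the Hermitian pairing of two flat sections has zero derivative, because the connection
is unitary (`hasFDerivAt_pairing`). Pairings of parallel lifts are therefore constant along the
path, which yields both uniqueness and the isometry property.

Existence. The curvature is a multiple of `ω`, which vanishes on the polarization, so the connection
form pulls back to a closed form on an integral manifold. With a primitive `F` on a ball, `exp (i
F)` is a unitary flat coefficient (`exists_flatCoeff`). Local lifts are rescaled and glued along
`[0,1]` by connectedness.

Bohr-Sommerfeld. A covariantly constant section is preserved by transport along every leafwise
orbifold path. If it is nonzero somewhere, it is nonzero all over the leaf, and since the fibres are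
lines every loop acts trivially. Conversely, a nonzero vector at a base point is spread over the
leaf by transport. Trivial holonomy makes the result path-independent, jumps give equivariance, and
comparison with local flat sections gives smoothness and flatness. -/

noncomputable section

/-! ### Real and imaginary parts in conjugation-invariant subspaces -/

section Complexification

variable {m : ℕ}

/-- The real part of complexified vectors, as a continuous linear map. -/
def reVecCLM (m : ℕ) : CSpace m →L[ℝ] RSpace m :=
  LinearMap.toContinuousLinearMap
    { toFun := reVec
      map_add' := fun z w => by ext j; simp [reVec]
      map_smul' := fun c z => by ext j; simp [reVec] }

/-- The imaginary part of complexified vectors, as a continuous linear map. -/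
def imVecCLM (m : ℕ) : CSpace m →L[ℝ] RSpace m :=
  LinearMap.toContinuousLinearMap
    { toFun := imVec
      map_add' := fun z w => by ext j; simp [imVec]
      map_smul' := fun c z => by ext j; simp [imVec] }

@[simp] theorem reVecCLM_apply (z : CSpace m) : reVecCLM m z = reVec z := rfl

@[simp] theorem imVecCLM_apply (z : CSpace m) : imVecCLM m z = imVec z := rfl

@[simp] theorem reVec_ofReIm (u v : RSpace m) : reVec (ofReIm u v) = u := by
  ext j; simp [reVec, ofReIm]

@[simp] theorem imVec_ofReIm (u v : RSpace m) : imVec (ofReIm u v) = v := by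
  ext j; simp [imVec, ofReIm]

theorem eq_zero_of_reVec_of_imVec {z : CSpace m} (hr : reVec z = 0) (hi : imVec z = 0) :
    z = 0 := by
  ext j
  have h1 := congrArg (fun v : RSpace m => v j) hr
  have h2 := congrArg (fun v : RSpace m => v j) hi
  exact Complex.ext (by simpa [reVec] using h1) (by simpa [imVec] using h2)

/-- The real part is the average of `z` and its conjugate. With the companion for imaginary parts,
this reduces statements about a real polarization to its real distribution. -/
theorem ofReIm_reVec_mem {S : Submodule ℂ (CSpace m)} (hS : ∀ z ∈ S, conjVec z ∈ S)
    {z : CSpace m} (hz : z ∈ S) : ofReIm (reVec z) 0 ∈ S := by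
  have : ofReIm (reVec z) 0 = (2⁻¹ : ℂ) • (z + conjVec z) := by
    ext j
    apply Complex.ext <;> simp [ofReIm, reVec, imVec, conjVec]
    ring
  rw [this]
  exact S.smul_mem _ (S.add_mem hz (hS z hz))

theorem ofReIm_imVec_mem {S : Submodule ℂ (CSpace m)} (hS : ∀ z ∈ S, conjVec z ∈ S)
    {z : CSpace m} (hz : z ∈ S) : ofReIm (imVec z) 0 ∈ S := by
  have : ofReIm (imVec z) 0 = ofReIm (reVec (-Complex.I • z)) 0 := by
    congr 1
    ext j; simp [reVec, imVec]
  rw [this]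
  exact ofReIm_reVec_mem hS (S.smul_mem _ hz)

end Complexification

/-! ### Integral manifolds as local graphs over `ℝⁿ` -/

namespace OrbifoldPolarization

variable {n : ℕ} {X : Type*} [TopologicalSpace X] {A : OrbifoldAtlas (2 * n) X}
  {Ω : OrbifoldSymplecticForm A} {P : OrbifoldPolarization Ω}

/-- Near a point where the linear projection `p` to `ℝⁿ` is injective on the real distribution, the
distribution consists of graphs over `ℝⁿ` depending smoothly on the point. -/
theorem exists_slope (hP : P.IsReal) {i : A.Idx} {x₀ : RSpace (2 * n)} (hx₀ : x₀ ∈ A.V i)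
    (p : RSpace (2 * n) →L[ℝ] RSpace n) (hp : ∀ v ∈ P.realPart i x₀, p v = 0 → v = 0) :
    ∃ B : RSpace (2 * n) → RSpace n →L[ℝ] RSpace (2 * n), ContDiffAt ℝ 1 B x₀ ∧
      ∀ᶠ x in 𝓝 x₀, ∀ v ∈ P.realPart i x, v = B x (p v) := by
  obtain ⟨O, hO, hxO, hOV, ξ, hξ, hspan⟩ := P.smooth i x₀ hx₀
  set F : RSpace (2 * n) → (Fin n → ℂ) →L[ℝ] CSpace (2 * n) := fun x =>
    ∑ j, ((ContinuousLinearMap.toSpanSingleton ℂ (ξ j x)).restrictScalars ℝ).comp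
      (ContinuousLinearMap.proj j) with hF
  have hFa : ∀ x a, F x a = ∑ j, a j • ξ j x := fun x a => by
    simp [hF]
  have hFs : ContDiffAt ℝ ∞ F x₀ := by
    refine ContDiffOn.contDiffAt (s := O) ?_ (hO.mem_nhds hxO)
    rw [contDiffOn_clm_apply]
    intro a
    simp only [hFa]
    exact ContDiffOn.sum fun j _ => (hξ j).const_smul (a j)
  -- The given frame is complex, so `p` is applied to real and imaginary parts separately. In frame
  -- coordinates this is a map between real spaces of equal dimension `2n`; it is invertible at
  -- `x₀`, hence nearby with smooth inverse.
  set pC : CSpace (2 * n) →L[ℝ] RSpace n × RSpace n :=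
    (p.comp (reVecCLM _)).prod (p.comp (imVecCLM _)) with hpC
  set M : RSpace (2 * n) → (Fin n → ℂ) →L[ℝ] RSpace n × RSpace n := fun x => pC.comp (F x) with hM
  have hMs : ContDiffAt ℝ ∞ M x₀ := contDiffAt_const.clm_comp hFs
  have hli : LinearIndependent ℂ fun j => ξ j x₀ := by
    rw [linearIndependent_iff_card_eq_finrank_span, Set.finrank, ← hspan x₀ hxO,
      P.finrank_eq i x₀ hx₀, Fintype.card_fin]
  have hinj : Function.Injective (M x₀) := by
    rw [injective_iff_map_eq_zero]
    intro a ha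
    have hz : F x₀ a ∈ P.sub i x₀ := by
      rw [hspan x₀ hxO, hFa]
      exact Submodule.sum_mem _ fun j _ =>
        Submodule.smul_mem _ _ (Submodule.subset_span ⟨j, rfl⟩)
    have ha' : p (reVec (F x₀ a)) = 0 ∧ p (imVec (F x₀ a)) = 0 := by
      simpa [hM, hpC] using ha
    have hz0 : F x₀ a = 0 := eq_zero_of_reVec_of_imVec
      (hp _ (ofReIm_reVec_mem (hP i x₀ hx₀) hz) ha'.1)
      (hp _ (ofReIm_imVec_mem (hP i x₀ hx₀) hz) ha'.2)
    rw [hFa] at hz0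
    exact funext (Fintype.linearIndependent_iff.1 hli a hz0)
  have hfr : Module.finrank ℝ (Fin n → ℂ) = Module.finrank ℝ (RSpace n × RSpace n) := by
    simp [Module.finrank_pi_fintype, mul_two]
  set e : (Fin n → ℂ) ≃L[ℝ] RSpace n × RSpace n :=
    (LinearEquiv.ofInjectiveOfFinrankEq (M x₀).toLinearMap hinj hfr).toContinuousLinearEquiv
  have he : (e : (Fin n → ℂ) →L[ℝ] RSpace n × RSpace n) = M x₀ := by
    ext a : 1; rfl
  have hinv : ContDiffAt ℝ ∞ (fun x => ContinuousLinearMap.inverse (M x)) x₀ :=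
    have hi : ContDiffAt ℝ ∞ ContinuousLinearMap.inverse (M x₀) := he ▸ contDiffAt_map_inverse e
    hi.comp x₀ hMs
  -- For `v` in the real distribution, `(p v, 0)` is the image under `M x` of the frame coordinates
  -- of `v + i0`; applying `F x` and taking the real part recovers `v`.
  refine ⟨fun x => ((reVecCLM _).comp (F x)).comp ((ContinuousLinearMap.inverse (M x)).comp
    (ContinuousLinearMap.inl ℝ _ _)), ?_, ?_⟩
  · exact ((contDiffAt_const.clm_comp hFs).clm_comp (hinv.clm_comp contDiffAt_const)).of_le
      (by simp)
  · have hev : ∀ᶠ x in 𝓝 x₀, M x ∈ Set.range ((↑) : ((Fin n → ℂ) ≃L[ℝ] RSpace n × RSpace n) → _) :=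
      hMs.continuousAt.eventually_mem (he ▸ e.nhds)
    filter_upwards [hev, hO.mem_nhds hxO] with x ⟨e', he'⟩ hx v hv
    have hv' : ofReIm v 0 ∈ P.sub i x := hv
    rw [hspan x hx, Submodule.mem_span_range_iff_exists_fun] at hv'
    obtain ⟨a, ha⟩ := hv'
    rw [← hFa] at ha
    have h1 : M x a = (p v, 0) := by simp [hM, hpC, ha]
    have h2 : ContinuousLinearMap.inverse (M x) (p v, 0) = a := by
      rw [← h1, ← he']; simp
    simp [h2, ha]

namespace Plaque

theorem hasFDerivAt {i : A.Idx} (Q : P.Plaque i) {w : RSpace n} (hw : w ∈ Q.dom) :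
    HasFDerivAt Q.toFun (fderiv ℝ Q.toFun w) w :=
  ((Q.smooth.contDiffAt (Q.isOpen_dom.mem_nhds hw)).differentiableAt (by simp)).hasFDerivAt

theorem continuousAt {i : A.Idx} (Q : P.Plaque i) {w : RSpace n} (hw : w ∈ Q.dom) :
    ContinuousAt Q.toFun w :=
  (Q.hasFDerivAt hw).continuousAt

theorem fderiv_mem {i : A.Idx} (Q : P.Plaque i) {w : RSpace n} (hw : w ∈ Q.dom) (v : RSpace n) :
    fderiv ℝ Q.toFun w v ∈ P.realPart i (Q.toFun w) := by
  rw [← Q.range_fderiv w hw]; exact ⟨v, rfl⟩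

/-- The restriction of an integral manifold to an open subset of its parameter domain. -/
def restrict {i : A.Idx} (Q : P.Plaque i) (O : Set (RSpace n)) (hO : IsOpen O)
    (hOQ : O ⊆ Q.dom) : P.Plaque i where
  dom := O
  isOpen_dom := hO
  toFun := Q.toFun
  smooth := Q.smooth.mono hOQ
  mapsTo := Q.mapsTo.mono_left hOQ
  range_fderiv := fun w hw => Q.range_fderiv w (hOQ hw)

/-- The differentials of an integral manifold of a real polarization are injective. -/
theorem fderiv_injective (hP : P.IsReal) {i : A.Idx} (Q : P.Plaque i) {w : RSpace n}
    (hw : w ∈ Q.dom) : Function.Injective (fderiv ℝ Q.toFun w) := by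
  have hV := Q.mapsTo hw
  set T := fderiv ℝ Q.toFun w
  -- The polarization is spanned over `ℂ` by the `n` images of the basis vectors. As its rank is
  -- `n`, these images are independent, which is injectivity.
  have hspan : P.sub i (Q.toFun w)
      ≤ Submodule.span ℂ (Set.range fun j => ofReIm (T (EuclideanSpace.single j 1)) 0) := by
    have key : ∀ v : RSpace n, ofReIm (T v) 0 ∈
        Submodule.span ℂ (Set.range fun j => ofReIm (T (EuclideanSpace.single j 1)) 0) := by
      intro v
      have hv : v = ∑ j, v j • EuclideanSpace.single j (1 : ℝ) := by
        ext k; simp [Finset.sum_apply, Pi.single_apply]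
      have : ofReIm (T v) 0
          = ∑ j, ((v j : ℝ) : ℂ) • ofReIm (T (EuclideanSpace.single j 1)) 0 := by
        conv_lhs => rw [hv]
        ext k
        apply Complex.ext <;> simp [ofReIm, map_sum]
      rw [this]
      exact Submodule.sum_mem _ fun j _ => Submodule.smul_mem _ _ (Submodule.subset_span ⟨j, rfl⟩)
    intro z hz
    have h1 := ofReIm_reVec_mem (hP i _ hV) hz
    have h2 := ofReIm_imVec_mem (hP i _ hV) hz
    obtain ⟨v, hv⟩ : reVec z ∈ Set.range T := by rw [Q.range_fderiv w hw]; exact h1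
    obtain ⟨v', hv'⟩ : imVec z ∈ Set.range T := by rw [Q.range_fderiv w hw]; exact h2
    have : z = ofReIm (T v) 0 + Complex.I • ofReIm (T v') 0 := by
      rw [hv, hv']
      ext j
      apply Complex.ext <;> simp [ofReIm, reVec, imVec]
    rw [this]
    exact Submodule.add_mem _ (key v) (Submodule.smul_mem _ _ (key v'))
  have hle := Submodule.finrank_mono hspan
  rw [P.finrank_eq i _ hV] at hle
  have hli : LinearIndependent ℂ fun j => ofReIm (T (EuclideanSpace.single j 1)) 0 := by
    rw [linearIndependent_iff_card_le_finrank_span, Fintype.card_fin]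
    exact hle
  rw [injective_iff_map_eq_zero]
  intro v hv
  have hv1 : v = ∑ j, v j • EuclideanSpace.single j (1 : ℝ) := by
    ext k; simp [Finset.sum_apply, Pi.single_apply]
  have h0 : ∑ j, ((v j : ℝ) : ℂ) • ofReIm (T (EuclideanSpace.single j 1)) 0 = 0 := by
    rw [hv1] at hv
    ext k
    have := congrArg (fun u : RSpace (2 * n) => u k) hv
    apply Complex.ext <;> simp [ofReIm]
    simpa [map_sum] using this
  ext j
  have := Fintype.linearIndependent_iff.1 hli (fun j => ((v j : ℝ) : ℂ)) h0 j
  simpa using this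

/-- A local inverse `h` of the projection `p ∘ Q` of an integral manifold to `ℝⁿ`. -/
theorem exists_adapted (hP : P.IsReal) {i : A.Idx} (Q : P.Plaque i) {w₀ : RSpace n}
    (hw₀ : w₀ ∈ Q.dom) (p : RSpace (2 * n) →L[ℝ] RSpace n)
    (hp : ∀ v ∈ P.realPart i (Q.toFun w₀), p v = 0 → v = 0) :
    ∃ h : RSpace n → RSpace n,
      (∀ᶠ y in 𝓝 (p (Q.toFun w₀)), h y ∈ Q.dom ∧ DifferentiableAt ℝ h y ∧ p (Q.toFun (h y)) = y) ∧
      ∀ᶠ w in 𝓝 w₀, h (p (Q.toFun w)) = w := by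
  have hinj : Function.Injective (p.comp (fderiv ℝ Q.toFun w₀)) := by
    rw [injective_iff_map_eq_zero]
    intro v hv
    have := hp _ (Q.fderiv_mem hw₀ v) hv
    exact (injective_iff_map_eq_zero _).1 (Q.fderiv_injective hP hw₀) v this
  set e : RSpace n ≃L[ℝ] RSpace n :=
    (LinearEquiv.ofInjectiveEndo (p.comp (fderiv ℝ Q.toFun w₀)).toLinearMap
      hinj).toContinuousLinearEquiv
  have hd : HasFDerivAt (fun w => p (Q.toFun w)) (e : RSpace n →L[ℝ] RSpace n) w₀ :=
    p.hasFDerivAt.comp w₀ (Q.hasFDerivAt hw₀)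
  have hs : ContDiffAt ℝ ∞ (fun w => p (Q.toFun w)) w₀ :=
    p.contDiff.contDiffAt.comp w₀ (Q.smooth.contDiffAt (Q.isOpen_dom.mem_nhds hw₀))
  have hstrict := hs.hasStrictFDerivAt' hd (by simp)
  have hsymm : ContDiffAt ℝ ∞ (hs.localInverse hd (by simp)) (p (Q.toFun w₀)) :=
    hs.to_localInverse hd (by simp)
  refine ⟨hs.localInverse hd (by simp), ?_, hstrict.eventually_left_inverse⟩
  have h0 : hs.localInverse hd (by simp) (p (Q.toFun w₀)) = w₀ :=
    hstrict.eventually_left_inverse.self_of_nhds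
  have h1 : ∀ᶠ y in 𝓝 (p (Q.toFun w₀)), hs.localInverse hd (by simp) y ∈ Q.dom :=
    hsymm.continuousAt.eventually_mem (by rw [h0]; exact Q.isOpen_dom.mem_nhds hw₀)
  have h2 : ∀ᶠ y in 𝓝 (p (Q.toFun w₀)),
      DifferentiableAt ℝ (hs.localInverse hd (by simp)) y :=
    ((hsymm.of_le (m := 1) (by simp)).eventually (by simp)).mono
      fun y hy => hy.differentiableAt (by simp)
  filter_upwards [h1, h2, hstrict.eventually_right_inverse] with y a b c using ⟨a, b, c⟩

/-- Two integral manifolds through a point coincide near it, as graphs over `ℝⁿ`. -/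
theorem adapted_eq (hP : P.IsReal) {i : A.Idx} (Q Q' : P.Plaque i) {x₀ : RSpace (2 * n)}
    (hx₀ : x₀ ∈ A.V i) (p : RSpace (2 * n) →L[ℝ] RSpace n)
    (hp : ∀ v ∈ P.realPart i x₀, p v = 0 → v = 0) (h h' : RSpace n → RSpace n)
    (hQ : ∀ᶠ y in 𝓝 (p x₀), h y ∈ Q.dom ∧ DifferentiableAt ℝ h y ∧ p (Q.toFun (h y)) = y)
    (hQ' : ∀ᶠ y in 𝓝 (p x₀), h' y ∈ Q'.dom ∧ DifferentiableAt ℝ h' y ∧ p (Q'.toFun (h' y)) = y)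
    (h0 : Q.toFun (h (p x₀)) = x₀) (h0' : Q'.toFun (h' (p x₀)) = x₀) :
    ∀ᶠ y in 𝓝 (p x₀), Q.toFun (h y) = Q'.toFun (h' y) := by
  obtain ⟨B, hB, hBev⟩ := exists_slope hP hx₀ p hp
  obtain ⟨K, T, hT, hLip⟩ := hB.exists_lipschitzOnWith
  -- Since `p ∘ Q ∘ h` is the identity, a derivative of `Q ∘ h` in direction `v` lies in the
  -- distribution and projects to `v`; so it is `B v` at the current point.
  have hd : ∀ (Q : P.Plaque i) (h : RSpace n → RSpace n),
      (∀ᶠ y in 𝓝 (p x₀), h y ∈ Q.dom ∧ DifferentiableAt ℝ h y ∧ p (Q.toFun (h y)) = y) →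
      Q.toFun (h (p x₀)) = x₀ →
      ∀ᶠ y in 𝓝 (p x₀), Q.toFun (h y) ∈ T ∧
        HasFDerivAt (fun y => Q.toFun (h y)) (B (Q.toFun (h y))) y := by
    intro Q h hQ h0
    have hcont : ContinuousAt (fun y => Q.toFun (h y)) (p x₀) :=
      ContinuousAt.comp (Q.continuousAt hQ.self_of_nhds.1) hQ.self_of_nhds.2.1.continuousAt
    have hmem := hcont.eventually_mem (by rw [h0]; exact Filter.inter_mem hT hBev)
    filter_upwards [hmem, hQ.eventually_nhds] with y hy hyQ
    refine ⟨hy.1, ?_⟩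
    obtain ⟨hy1, hy2, -⟩ := hyQ.self_of_nhds
    have hD := (Q.hasFDerivAt hy1).comp y hy2.hasFDerivAt
    have hpD := p.hasFDerivAt.comp y hD
    have hid : p.comp ((fderiv ℝ Q.toFun (h y)).comp (fderiv ℝ h y)) = ContinuousLinearMap.id ℝ _ :=
      hpD.unique ((hasFDerivAt_id y).congr_of_eventuallyEq (hyQ.mono fun z hz => hz.2.2))
    convert! hD using 1
    ext1 v
    have h1 := hy.2 _ (Q.fderiv_mem hy1 (fderiv ℝ h y v))
    have h2 := congrArg (fun S : RSpace n →L[ℝ] RSpace n => S v) hid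
    simp only [ContinuousLinearMap.comp_apply, ContinuousLinearMap.id_apply] at h2
    rw [h2] at h1
    exact h1.symm
  obtain ⟨ε, hε, hball⟩ := Metric.eventually_nhds_iff_ball.1 ((hd Q h hQ h0).and (hd Q' h' hQ' h0'))
  filter_upwards [Metric.ball_mem_nhds _ hε] with y hy
  -- Along the ray from `p x₀` to `y` both graphs solve the autonomous ODE `x' = B x (y - p x₀)`
  -- with initial value `x₀`; the Lipschitz bound on `T` forces them to agree at time 1.
  set ℓ : ℝ → RSpace n := fun t => p x₀ + t • (y - p x₀) with hℓ
  have hℓmem : ∀ t ∈ Set.Icc (0 : ℝ) 1, ℓ t ∈ Metric.ball (p x₀) ε := by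
    intro t ht
    rw [Metric.mem_ball, dist_eq_norm] at hy ⊢
    calc ‖ℓ t - p x₀‖ = |t| * ‖y - p x₀‖ := by simp [hℓ, norm_smul]
      _ ≤ 1 * ‖y - p x₀‖ := by
        gcongr; rw [abs_of_nonneg ht.1]; exact ht.2
      _ < ε := by rwa [one_mul]
  have hℓd : ∀ t, HasDerivAt ℓ (y - p x₀) t := fun t => by
    have := ((hasDerivAt_id t).smul_const (y - p x₀)).const_add (p x₀)
    rwa [one_smul] at this
  have hg : ∀ t ∈ Set.Icc (0 : ℝ) 1, HasDerivAt (fun t => Q.toFun (h (ℓ t)))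
      (B (Q.toFun (h (ℓ t))) (y - p x₀)) t := fun t ht =>
    (hball _ (hℓmem t ht)).1.2.comp_hasDerivAt t (hℓd t)
  have hg' : ∀ t ∈ Set.Icc (0 : ℝ) 1, HasDerivAt (fun t => Q'.toFun (h' (ℓ t)))
      (B (Q'.toFun (h' (ℓ t))) (y - p x₀)) t := fun t ht =>
    (hball _ (hℓmem t ht)).2.2.comp_hasDerivAt t (hℓd t)
  have hv : LipschitzOnWith (K * ‖y - p x₀‖₊) (fun x => B x (y - p x₀)) T := by
    refine LipschitzOnWith.of_dist_le_mul fun a ha b hb => ?_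
    have := hLip.dist_le_mul a ha b hb
    rw [dist_eq_norm] at this ⊢
    calc ‖B a (y - p x₀) - B b (y - p x₀)‖ ≤ ‖B a - B b‖ * ‖y - p x₀‖ :=
          (B a - B b).le_opNorm _
      _ ≤ (K * dist a b) * ‖y - p x₀‖ := by gcongr
      _ = _ := by simp; ring
  have := ODE_solution_unique_of_mem_Icc_right (v := fun _ x => B x (y - p x₀)) (s := fun _ => T)
    (fun t _ => hv) (fun t ht => (hg t ht).continuousAt.continuousWithinAt)
    (fun t ht => (hg t (Set.Ico_subset_Icc_self ht)).hasDerivWithinAt)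
    (fun t ht => (hball _ (hℓmem t (Set.Ico_subset_Icc_self ht))).1.1)
    (fun t ht => (hg' t ht).continuousAt.continuousWithinAt)
    (fun t ht => (hg' t (Set.Ico_subset_Icc_self ht)).hasDerivWithinAt)
    (fun t ht => (hball _ (hℓmem t (Set.Ico_subset_Icc_self ht))).2.1)
    (by simp [hℓ, h0, h0'])
  simpa [hℓ] using this (Set.right_mem_Icc.2 zero_le_one)

/-- A linear projection to `ℝⁿ` which is injective on the real distribution at a point of an
integral manifold. -/
theorem exists_projection (hP : P.IsReal) {i : A.Idx} (Q : P.Plaque i) {w₀ : RSpace n}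
    (hw₀ : w₀ ∈ Q.dom) : ∃ p : RSpace (2 * n) →L[ℝ] RSpace n,
      ∀ v ∈ P.realPart i (Q.toFun w₀), p v = 0 → v = 0 := by
  obtain ⟨g, hg⟩ := LinearMap.exists_leftInverse_of_injective
    (fderiv ℝ Q.toFun w₀).toLinearMap (LinearMap.ker_eq_bot.2 (Q.fderiv_injective hP hw₀))
  refine ⟨LinearMap.toContinuousLinearMap g, fun v hv hv0 => ?_⟩
  rw [← Q.range_fderiv w₀ hw₀] at hv
  obtain ⟨w, rfl⟩ := hv
  have := LinearMap.congr_fun hg w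
  have hw : w = 0 := by
    rw [← show g (fderiv ℝ Q.toFun w₀ w) = w from this]; exact hv0
  rw [hw, map_zero]

end Plaque

end OrbifoldPolarization

end

/-! ### Constancy of Hermitian pairings and uniqueness of parallel lifts -/

noncomputable section

/-- Whether two vectors are equal is determined by their Gram matrix. -/
theorem eq_iff_eq_of_inner_eq {E F : Type*} [NormedAddCommGroup E] [InnerProductSpace ℂ E]
    [NormedAddCommGroup F] [InnerProductSpace ℂ F] {x y : E} {x' y' : F}
    (h1 : inner ℂ x x = inner ℂ x' x') (h2 : inner ℂ x y = inner ℂ x' y')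
    (h3 : inner ℂ y y = inner ℂ y' y') : x = y ↔ x' = y' := by
  have e : inner ℂ (x - y) (x - y) = inner ℂ (x' - y') (x' - y') := by
    simp only [inner_sub_left, inner_sub_right, h1, h2, h3, ← inner_conj_symm (𝕜 := ℂ) y x,
      ← inner_conj_symm (𝕜 := ℂ) y' x']
  rw [← sub_eq_zero, ← inner_self_eq_zero (𝕜 := ℂ), e, inner_self_eq_zero, sub_eq_zero]

namespace OrbifoldLineBundle

section

variable {m : ℕ} {X : Type*} [TopologicalSpace X] {A : OrbifoldAtlas m X}

/-- The cocycle rule for `1 * 1 = 1` makes this map idempotent, and an injective idempotent is the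
identity. -/
theorem trans_autEmb_one (L : OrbifoldLineBundle A) {i : A.Idx} (x : A.V i)
    (h : ((A.chart i).autEmb 1).toFun x = (x : RSpace m)) (v : L.fiber ⟨i, x⟩) :
    L.trans ((A.chart i).autEmb 1) x x h v = v := by
  apply (L.trans ((A.chart i).autEmb 1) x x h).injective
  refine (L.trans_comp ((A.chart i).autEmb 1) ((A.chart i).autEmb 1) ((A.chart i).autEmb 1)
    (fun y hy => ?_) x x x h h h v).symm
  exact ((A.chart i).act_one _ ((A.chart i).act_mem 1 hy)).symm

/-- The change of frame between two local unitary frames of a chart, and the gauge transformation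
law of the connection forms. -/
theorem UnitaryConnection.exists_gauge {L : OrbifoldLineBundle A} (D : L.UnitaryConnection)
    {i : A.Idx} (a b : L.Frame i) : ∃ H : RSpace m → ℂ,
      (∀ x ∈ L.O i a ∩ L.O i b, DifferentiableAt ℝ H x ∧ ∀ v : RSpace m,
        fderiv ℝ H x v = -Complex.I * ((D.pot i a x ![v] - D.pot i b x ![v] : ℝ) : ℂ) * H x) ∧
      ∀ x : A.V i, (x : RSpace m) ∈ L.O i a → (x : RSpace m) ∈ L.O i b →
        L.frame i a x = H x • L.frame i b x := by
  -- A change of frame within a chart is the bundle map over the unit of the local group. That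
  -- embedding is the identity only on `V`, so its derivative is computed from equality near `x`.
  obtain ⟨H, hH, hfr⟩ := L.trans_smooth ((A.chart i).autEmb 1) a b
  have hone : ∀ x ∈ A.V i, ((A.chart i).autEmb 1).toFun x = x := (A.chart i).act_one
  have hset : L.O i a ∩ L.O i b ⊆ L.O i a ∩ ((A.chart i).autEmb 1).toFun ⁻¹' L.O i b := by
    rintro x ⟨hxa, hxb⟩
    refine ⟨hxa, ?_⟩
    rw [Set.mem_preimage, hone x (L.O_subset i a hxa)]
    exact hxb
  refine ⟨H, fun x hx => ⟨?_, fun v => ?_⟩, fun x hxa hxb => ?_⟩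
  · exact ((hH.mono hset).contDiffAt
      (((L.isOpen_O i a).inter (L.isOpen_O i b)).mem_nhds hx)).differentiableAt (by simp)
  · have hxV := L.O_subset i a hx.1
    have hev : ((A.chart i).autEmb 1).toFun =ᶠ[𝓝 x] id := by
      filter_upwards [(A.chart i).isOpen_V.mem_nhds hxV] with y hy using hone y hy
    rw [D.compat ((A.chart i).autEmb 1) a b H hH hfr x (hset hx) v, hone x hxV, hev.fderiv_eq]
    simp
  · rw [← hfr x x (hone x x.2) hxa hxb, L.trans_autEmb_one]

end

variable {n : ℕ} {X : Type*} [TopologicalSpace X] {A : OrbifoldAtlas (2 * n) X}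
  {Ω : OrbifoldSymplecticForm A} {L : OrbifoldLineBundle A} {P : OrbifoldPolarization Ω}

/-- The family `σ` along `γ` is, near the parameter `t`, the restriction to `γ` of a smooth
covariantly constant section along an integral manifold. -/
def UnitaryConnection.IsParallelAt (D : L.UnitaryConnection)
    {i : A.Idx} (γ : P.LeafSegment i) (σ : ∀ t, L.fiber ⟨i, γ.toFun t⟩) (t : unitInterval) :
    Prop :=
  ∃ (Q : P.Plaque i) (a : L.Frame i) (u : RSpace n → ℂ) (c : unitInterval → RSpace n),
    Set.MapsTo Q.toFun Q.dom (L.O i a) ∧ IsSmoothCoeff Q u ∧ D.IsFlatCoeff Q a u ∧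
    ∃ N ∈ 𝓝 t, ContinuousOn c N ∧ Set.MapsTo c N Q.dom ∧
      ∀ s ∈ N, (γ.toFun s : RSpace (2 * n)) = Q.toFun (c s) ∧
        σ s = u (c s) • L.frame i a (γ.toFun s)

theorem IsSmoothCoeff.hasFDerivAt {i : A.Idx} {Q : P.Plaque i} {u : RSpace n → ℂ}
    (hu : IsSmoothCoeff Q u) {w : RSpace n} (hw : w ∈ Q.dom) :
    HasFDerivAt u (fderiv ℝ u w) w :=
  ((ContDiffOn.contDiffAt hu (Q.isOpen_dom.mem_nhds hw)).differentiableAt (by simp)).hasFDerivAt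

namespace UnitaryConnection

/-- The pairing of two covariantly constant sections along integral manifolds, in terms of a common
parametrization `f` of these manifolds, has derivative zero. -/
theorem hasFDerivAt_pairing (D : L.UnitaryConnection) {i : A.Idx} {Q Q' : P.Plaque i}
    {a a' : L.Frame i} {u u' : RSpace n → ℂ} (hQ : Set.MapsTo Q.toFun Q.dom (L.O i a))
    (hQ' : Set.MapsTo Q'.toFun Q'.dom (L.O i a')) (hus : IsSmoothCoeff Q u)
    (hus' : IsSmoothCoeff Q' u') (hu : D.IsFlatCoeff Q a u) (hu' : D.IsFlatCoeff Q' a' u')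
    {H : RSpace (2 * n) → ℂ}
    (hH : ∀ x ∈ L.O i a ∩ L.O i a', DifferentiableAt ℝ H x ∧ ∀ v : RSpace (2 * n),
        fderiv ℝ H x v = -Complex.I * ((D.pot i a x ![v] - D.pot i a' x ![v] : ℝ) : ℂ) * H x)
    {h h' : RSpace n → RSpace n} {y : RSpace n} (hy : h y ∈ Q.dom) (hy' : h' y ∈ Q'.dom)
    (hd : DifferentiableAt ℝ h y) (hd' : DifferentiableAt ℝ h' y)
    (heq : ∀ᶠ z in 𝓝 y, Q.toFun (h z) = Q'.toFun (h' z)) :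
    HasFDerivAt (fun z => (starRingEnd ℂ) (u (h z) * H (Q.toFun (h z))) * u' (h' z))
      (0 : RSpace n →L[ℝ] ℂ) y := by
  have hx : Q.toFun (h y) ∈ L.O i a ∩ L.O i a' :=
    ⟨hQ hy, by rw [heq.self_of_nhds]; exact hQ' hy'⟩
  have dQ := (Q.hasFDerivAt hy).comp y hd.hasFDerivAt
  have dQ' := (Q'.hasFDerivAt hy').comp y hd'.hasFDerivAt
  have dQQ := dQ.unique (dQ'.congr_of_eventuallyEq heq)
  have du := (hus.hasFDerivAt hy).comp y hd.hasFDerivAt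
  have du' := (hus'.hasFDerivAt hy').comp y hd'.hasFDerivAt
  have dH := (hH _ hx).1.hasFDerivAt.comp y dQ
  have dG := (Complex.conjCLE.toContinuousLinearMap.hasFDerivAt.comp y (du.mul dH)).mul du'
  refine HasFDerivAt.congr_fderiv dG ?_
  ext1 v
  -- With `α`, `α'` the two connection forms, `du = iαu` and `dH = -i(α - α')H` give `d(uH) =
  -- iα'uH`. Conjugation turns this into `-iα'`, which cancels `du' = iα'u'`.
  have e1 := sub_eq_zero.1 (hu _ hy (fderiv ℝ h y v))
  have e2 := sub_eq_zero.1 (hu' _ hy' (fderiv ℝ h' y v))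
  have e3 := (hH _ hx).2 (fderiv ℝ Q.toFun (h y) (fderiv ℝ h y v))
  have e4 := congrArg (fun S : RSpace n →L[ℝ] RSpace (2 * n) => S v) dQQ
  simp only [ContinuousLinearMap.comp_apply] at e4
  rw [← e4, ← heq.self_of_nhds] at e2
  simp [e1, e2, e3]
  ring

/-- The pairing of two families parallel near `t` is constant near `t`. -/
theorem IsParallelAt.eventually_inner_eq (hP : P.IsReal) {D : L.UnitaryConnection} {i : A.Idx}
    {γ : P.LeafSegment i} {σ σ' : ∀ t, L.fiber ⟨i, γ.toFun t⟩} {t : unitInterval}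
    (hσ : D.IsParallelAt γ σ t) (hσ' : D.IsParallelAt γ σ' t) :
    ∀ᶠ s in 𝓝 t, Inner.inner ℂ (σ s) (σ' s) = Inner.inner ℂ (σ t) (σ' t) := by
  obtain ⟨Q, a, u, c, hQ, hus, hu, N, hN, hc, hcN, hγ⟩ := hσ
  obtain ⟨Q', a', u', c', hQ', hus', hu', N', hN', hc', hcN', hγ'⟩ := hσ'
  have ht := mem_of_mem_nhds hN
  have ht' := mem_of_mem_nhds hN'
  obtain ⟨H, hH, hfr⟩ := D.exists_gauge a a'
  obtain ⟨p, hp⟩ := Q.exists_projection hP (hcN ht)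
  have hxQ : (γ.toFun t : RSpace (2 * n)) = Q.toFun (c t) := (hγ t ht).1
  have hxQ' : (γ.toFun t : RSpace (2 * n)) = Q'.toFun (c' t) := (hγ' t ht').1
  obtain ⟨h, hh, hinv⟩ := Q.exists_adapted hP (hcN ht) p hp
  obtain ⟨h', hh', hinv'⟩ := Q'.exists_adapted hP (hcN' ht') p (by rwa [← hxQ', hxQ])
  have h0 := hinv.self_of_nhds
  have h0' := hinv'.self_of_nhds
  rw [← hxQ] at hh hp h0
  rw [← hxQ'] at hh' h0'
  have heq := Q.adapted_eq hP Q' (γ.toFun t).2 p hp h h' hh hh'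
    (by rw [h0, hxQ]) (by rw [h0', hxQ'])
  obtain ⟨ε, hε, hball⟩ := Metric.eventually_nhds_iff_ball.1
    ((hh.and hh').and heq.eventually_nhds)
  set G : RSpace n → ℂ :=
    fun z => (starRingEnd ℂ) (u (h z) * H (Q.toFun (h z))) * u' (h' z) with hG
  have hGd : ∀ y ∈ Metric.ball (p (γ.toFun t)) ε, HasFDerivAt G (0 : RSpace n →L[ℝ] ℂ) y :=
    fun y hy => by
      obtain ⟨⟨⟨k1, k2, -⟩, ⟨k1', k2', -⟩⟩, k3⟩ := hball y hy
      exact D.hasFDerivAt_pairing hQ hQ' hus hus' hu hu' hH k1 k1' k2 k2' k3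
  have hconst : ∀ y ∈ Metric.ball (p (γ.toFun t)) ε, G y = G (p (γ.toFun t)) := fun y hy =>
    Metric.isOpen_ball.is_const_of_fderiv_eq_zero (convex_ball _ _).isPreconnected
      (fun z hz => (hGd z hz).differentiableAt.differentiableWithinAt)
      (fun z hz => (hGd z hz).fderiv) hy (Metric.mem_ball_self hε)
  -- The path is merely continuous, so nothing is differentiated along it: the pairing on the path
  -- is the locally constant `G` composed with the continuous map `p ∘ γ`.
  have hcc : ContinuousAt c t := hc.continuousAt hN
  have hcc' : ContinuousAt c' t := hc'.continuousAt hN'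
  have hpγ : Filter.Tendsto (fun s => p (γ.toFun s)) (𝓝 t) (𝓝 (p (γ.toFun t))) := by
    have : ContinuousAt (fun s => p (Q.toFun (c s))) t :=
      p.continuous.continuousAt.comp (ContinuousAt.comp (Q.continuousAt (hcN ht)) hcc)
    refine Filter.Tendsto.congr' ?_ (by rw [hxQ]; exact this)
    filter_upwards [hN] with s hs
    rw [(hγ s hs).1]
  have key : ∀ᶠ s in 𝓝 t, Inner.inner ℂ (σ s) (σ' s) = G (p (γ.toFun s)) := by
    filter_upwards [hN, hN', hcc.eventually hinv, hcc'.eventually hinv'] with s hs hs' i1 i2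
    rw [← (hγ s hs).1] at i1
    rw [← (hγ' s hs').1] at i2
    have hxa : (γ.toFun s : RSpace (2 * n)) ∈ L.O i a := by
      rw [(hγ s hs).1]; exact hQ (hcN hs)
    have hxa' : (γ.toFun s : RSpace (2 * n)) ∈ L.O i a' := by
      rw [(hγ' s hs').1]; exact hQ' (hcN' hs')
    simp only [hG, i1, i2]
    rw [← (hγ s hs).1, (hγ s hs).2, (hγ' s hs').2, hfr _ hxa hxa', smul_smul, inner_smul_left,
      inner_smul_right, inner_self_eq_norm_sq_to_K, L.norm_frame i a' _ hxa']
    simp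
  filter_upwards [key, hpγ.eventually (Metric.ball_mem_nhds _ hε)] with s hs hsb
  rw [hs, hconst _ hsb, key.self_of_nhds]

theorem IsParallelLift.inner_eq (hP : P.IsReal) {D : L.UnitaryConnection} {i : A.Idx}
    {γ : P.LeafSegment i} {σ σ' : ∀ t, L.fiber ⟨i, γ.toFun t⟩}
    (hσ : D.IsParallelLift γ σ) (hσ' : D.IsParallelLift γ σ') (s t : unitInterval) :
    Inner.inner ℂ (σ s) (σ' s) = Inner.inner ℂ (σ t) (σ' t) := by
  have : IsLocallyConstant fun s => Inner.inner ℂ (σ s) (σ' s) :=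
    (IsLocallyConstant.iff_eventually_eq _).2 fun t =>
      IsParallelAt.eventually_inner_eq hP (hσ t) (hσ' t)
  exact this.apply_eq_of_preconnectedSpace s t

/-- All entries of the Gram matrix of the two families are constant near `t`, so equality at `t`
spreads. This local form is what gluing requires. -/
theorem IsParallelAt.eventually_eq (hP : P.IsReal) {D : L.UnitaryConnection} {i : A.Idx}
    {γ : P.LeafSegment i} {σ σ' : ∀ t, L.fiber ⟨i, γ.toFun t⟩} {t : unitInterval}
    (hσ : D.IsParallelAt γ σ t) (hσ' : D.IsParallelAt γ σ' t) (h : σ t = σ' t) :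
    ∀ᶠ s in 𝓝 t, σ s = σ' s := by
  filter_upwards [eventually_inner_eq hP hσ hσ, eventually_inner_eq hP hσ hσ',
    eventually_inner_eq hP hσ' hσ'] with s h1 h2 h3
  exact (eq_iff_eq_of_inner_eq h1 h2 h3).2 h

/-- Parallel lifts are determined by one value. -/
theorem IsParallelLift.eq (hP : P.IsReal) {D : L.UnitaryConnection} {i : A.Idx}
    {γ : P.LeafSegment i} {σ σ' : ∀ t, L.fiber ⟨i, γ.toFun t⟩}
    (hσ : D.IsParallelLift γ σ) (hσ' : D.IsParallelLift γ σ') {s : unitInterval}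
    (h : σ s = σ' s) (t : unitInterval) : σ t = σ' t :=
  (eq_iff_eq_of_inner_eq (hσ.inner_eq hP hσ t s) (hσ.inner_eq hP hσ' t s)
    (hσ'.inner_eq hP hσ' t s)).2 h

end UnitaryConnection

end OrbifoldLineBundle

end

/-! ### Flat sections from closed connection forms, and existence of transport -/

noncomputable section

/-- A `1`-form as a linear functional. -/
def oneFormCLM (m : ℕ) : (RSpace m [⋀^Fin 1]→L[ℝ] ℝ) →L[ℝ] RSpace m →L[ℝ] ℝ :=
  ((ContinuousMultilinearMap.ofSubsingletonₗᵢ (𝕜 := ℝ) (G := RSpace m) (G' := ℝ)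
    (0 : Fin 1)).symm.toContinuousLinearEquiv : _ →L[ℝ] _).comp
      (ContinuousAlternatingMap.toContinuousMultilinearMapCLM ℝ)

theorem oneFormCLM_apply {m : ℕ} (α : RSpace m [⋀^Fin 1]→L[ℝ] ℝ) (v : RSpace m) :
    oneFormCLM m α v = α ![v] := by
  have : (![v] : Fin 1 → RSpace m) = fun _ => v := by ext i; simp
  rw [this]; rfl

/-- A smooth `1`-form whose pullback to a convex open set is closed has a smooth primitive there. -/
theorem exists_pullback_primitive {m k : ℕ} {α : RSpace m → RSpace m [⋀^Fin 1]→L[ℝ] ℝ}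
    {S : Set (RSpace m)} (hS : IsOpen S) (hα : ContDiffOn ℝ ∞ α S) {f : RSpace k → RSpace m}
    {O : Set (RSpace k)} (hO : IsOpen O) (hOc : Convex ℝ O) (hf : ContDiffOn ℝ ∞ f O)
    (hfS : Set.MapsTo f O S)
    (hcl : ∀ w ∈ O, ∀ u v, extDeriv α (f w) ![fderiv ℝ f w u, fderiv ℝ f w v] = 0) :
    ∃ F : RSpace k → ℝ, ContDiffOn ℝ ∞ F O ∧
      ∀ w ∈ O, ∀ v, fderiv ℝ F w v = α (f w) ![fderiv ℝ f w v] := by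
  set θ : RSpace k → RSpace k →L[ℝ] ℝ :=
    fun w => (oneFormCLM m (α (f w))).comp (fderiv ℝ f w) with hθ
  have hdf : ContDiffOn ℝ ∞ (fderiv ℝ f) O := hf.fderiv_of_isOpen hO (by simp)
  have hθs : ContDiffOn ℝ ∞ θ O :=
    ((oneFormCLM m).contDiff.comp_contDiffOn (hα.comp hf hfS)).clm_comp hdf
  have hθd : ∀ w ∈ O, DifferentiableAt ℝ θ w := fun w hw =>
    (hθs.contDiffAt (hO.mem_nhds hw)).differentiableAt (by simp)
  -- Symmetry of the derivative of `θ` is closedness of `f^*α`, and `d(f^*α) = f^*(dα)` vanishes by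
  -- `hcl`. The Poincaré lemma on a convex set then applies.
  have hsymm : ∀ w ∈ O, ∀ u v, fderiv ℝ θ w u v = fderiv ℝ θ w v u := by
    intro w hw u v
    have hfw := hf.contDiffAt (hO.mem_nhds hw)
    have hαw : DifferentiableAt ℝ α (f w) :=
      (hα.contDiffAt (hS.mem_nhds (hfS hw))).differentiableAt (by simp)
    have hpd : DifferentiableAt ℝ
        (fun w => (α (f w)).compContinuousLinearMap (fderiv ℝ f w)) w :=
      DifferentiableAt.continuousAlternatingMapCompContinuousLinearMap
        (hαw.comp w (hfw.differentiableAt (by simp)))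
        ((hdf.contDiffAt (hO.mem_nhds hw)).differentiableAt (by simp))
    have hθe : ∀ z : RSpace k, (fun w => (α (f w)).compContinuousLinearMap (fderiv ℝ f w) ![z])
        = fun w => θ w z := by
      intro z; ext w
      simp only [hθ, ContinuousLinearMap.comp_apply, oneFormCLM_apply]
      rw [ContinuousAlternatingMap.compContinuousLinearMap_apply]
      congr 1
      ext i; simp
    have hθz : ∀ z y : RSpace k, fderiv ℝ (fun w => θ w z) w y = fderiv ℝ θ w y z := by
      intro z y
      rw [fderiv_clm_apply (hθd w hw) (differentiableAt_const z)]
      simp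
    have e2 : (fderiv ℝ f w) ∘ ![u, v] = ![fderiv ℝ f w u, fderiv ℝ f w v] := by
      ext i; fin_cases i <;> rfl
    have e0 : (0 : Fin 2).removeNth ![u, v] = ![v] := by ext i; fin_cases i; rfl
    have e1 : (1 : Fin 2).removeNth ![u, v] = ![u] := by ext i; fin_cases i; rfl
    have h1 : extDeriv (fun w => (α (f w)).compContinuousLinearMap (fderiv ℝ f w)) w ![u, v]
        = 0 := by
      rw [extDeriv_pullback hαw hfw (by simpa using WithTop.coe_le_coe.2 (le_top : (2 : ℕ∞) ≤ ⊤)),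
        ContinuousAlternatingMap.compContinuousLinearMap_apply, e2, hcl w hw u v]
    rw [extDeriv_apply hpd, Fin.sum_univ_two, e0, e1, hθe, hθe, hθz, hθz] at h1
    simp at h1
    linarith
  obtain ⟨F, hF⟩ := hOc.exists_forall_hasFDerivAt_of_fderiv_symmetric hO
    (fun w hw => (hθd w hw).differentiableWithinAt) hsymm
  refine ⟨F, ?_, fun w hw v => ?_⟩
  · rw [contDiffOn_infty_iff_fderiv_of_isOpen hO]
    exact ⟨fun w hw => (hF w hw).differentiableAt.differentiableWithinAt,
      hθs.congr fun w hw => (hF w hw).fderiv⟩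
  · rw [(hF w hw).fderiv]
    simp [hθ, oneFormCLM_apply]

namespace OrbifoldLineBundle

variable {n : ℕ} {X : Type*} [TopologicalSpace X] {A : OrbifoldAtlas (2 * n) X}
  {Ω : OrbifoldSymplecticForm A} {L : OrbifoldLineBundle A} {P : OrbifoldPolarization Ω}

theorem _root_.OrbifoldPolarization.form_eq_zero {i : A.Idx} {x : RSpace (2 * n)}
    (hx : x ∈ A.V i) {u v : RSpace (2 * n)} (hu : u ∈ P.realPart i x) (hv : v ∈ P.realPart i x) :
    Ω.form i x ![u, v] = 0 := by
  have h := congrArg Complex.re (P.lagrangian i x hx _ hu _ hv)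
  have h0 : Ω.form i x ![0, 0] = 0 := (Ω.form i x).map_coord_zero 0 rfl
  simpa [complexifyForm, h0] using h

namespace UnitaryConnection

/-- A connection which is flat along an integral manifold has unitary covariantly constant sections
near each of its points. -/
theorem exists_flatCoeff (D : L.UnitaryConnection) {hbar : ℝ} (hD : D.IsPrequantum Ω hbar)
    {i : A.Idx} (Q : P.Plaque i) (a : L.Frame i) {w₀ : RSpace n} (hw₀ : w₀ ∈ Q.dom)
    (ha : Q.toFun w₀ ∈ L.O i a) :
    ∃ (O : Set (RSpace n)) (hO : IsOpen O) (hOQ : O ⊆ Q.dom) (u : RSpace n → ℂ),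
      w₀ ∈ O ∧ Convex ℝ O ∧ Set.MapsTo Q.toFun O (L.O i a) ∧
      IsSmoothCoeff (Q.restrict O hO hOQ) u ∧ D.IsFlatCoeff (Q.restrict O hO hOQ) a u ∧
      ∀ w, ‖u w‖ = 1 := by
  obtain ⟨ε, hε, hball⟩ := Metric.eventually_nhds_iff_ball.1
    ((Q.isOpen_dom.eventually_mem hw₀).and
      ((Q.continuousAt hw₀).eventually_mem ((L.isOpen_O i a).mem_nhds ha)))
  have hOQ : Metric.ball w₀ ε ⊆ Q.dom := fun w hw => (hball w hw).1
  have hOa : Set.MapsTo Q.toFun (Metric.ball w₀ ε) (L.O i a) := fun w hw => (hball w hw).2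
  obtain ⟨F, hF, hFd⟩ := exists_pullback_primitive (L.isOpen_O i a) (D.smooth i a)
    Metric.isOpen_ball (convex_ball w₀ ε) (Q.smooth.mono hOQ) hOa (fun w hw u v => by
      rw [hD i a _ (hOa hw), ContinuousAlternatingMap.smul_apply,
        P.form_eq_zero (Q.mapsTo (hOQ hw)) (Q.fderiv_mem (hOQ hw) u) (Q.fderiv_mem (hOQ hw) v),
        smul_zero])
  -- Here `dF` is the pulled-back connection form, so `exp (i F)` solves `du = i u A`; it has
  -- modulus one because `F` is real. Convexity of the ball is recorded for later transport along
  -- straight lines.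
  refine ⟨_, Metric.isOpen_ball, hOQ, fun w => Complex.exp (F w * Complex.I),
    Metric.mem_ball_self hε, convex_ball w₀ ε, hOa, ?_, ?_, fun w => Complex.norm_exp_ofReal_mul_I _⟩
  · exact ((Complex.ofRealCLM.contDiff.comp_contDiffOn hF).mul contDiffOn_const).cexp
  · intro w hw v
    have hFw : HasFDerivAt F (fderiv ℝ F w) w :=
      ((hF.contDiffAt (Metric.isOpen_ball.mem_nhds hw)).differentiableAt (by simp)).hasFDerivAt
    have hu := ((Complex.ofRealCLM.hasFDerivAt.comp w hFw).mul_const Complex.I).cexp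
    have hu' : fderiv ℝ (fun w => Complex.exp (F w * Complex.I)) w = _ := hu.fderiv
    rw [hu']
    change _ - Complex.I * ((D.pot i a (Q.toFun w) ![fderiv ℝ Q.toFun w v] : ℝ) : ℂ) * _ = 0
    rw [← hFd w hw v]
    simp
    ring

variable {D : L.UnitaryConnection} {i : A.Idx} {γ : P.LeafSegment i}

theorem IsParallelAt.congr {σ σ' : ∀ t, L.fiber ⟨i, γ.toFun t⟩} {t : unitInterval}
    (hσ : D.IsParallelAt γ σ t) (h : ∀ᶠ s in 𝓝 t, σ' s = σ s) : D.IsParallelAt γ σ' t := by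
  obtain ⟨Q, a, u, c, hQ, hus, hu, N, hN, hc, hcN, hγ⟩ := hσ
  exact ⟨Q, a, u, c, hQ, hus, hu, N ∩ {s | σ' s = σ s}, Filter.inter_mem hN h,
    hc.mono Set.inter_subset_left, hcN.mono_left Set.inter_subset_left,
    fun s hs => ⟨(hγ s hs.1).1, by rw [show σ' s = σ s from hs.2, (hγ s hs.1).2]⟩⟩

theorem IsParallelAt.eventually {σ : ∀ t, L.fiber ⟨i, γ.toFun t⟩} {t : unitInterval}
    (hσ : D.IsParallelAt γ σ t) : ∀ᶠ s in 𝓝 t, D.IsParallelAt γ σ s := by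
  obtain ⟨Q, a, u, c, hQ, hus, hu, N, hN, hc, hcN, hγ⟩ := hσ
  filter_upwards [eventually_mem_nhds_iff.2 hN] with s hs
  exact ⟨Q, a, u, c, hQ, hus, hu, N, hs, hc, hcN, hγ⟩

theorem IsParallelAt.smul {σ : ∀ t, L.fiber ⟨i, γ.toFun t⟩} {t : unitInterval}
    (hσ : D.IsParallelAt γ σ t) (z : ℂ) : D.IsParallelAt γ (fun s => z • σ s) t := by
  obtain ⟨Q, a, u, c, hQ, hus, hu, N, hN, hc, hcN, hγ⟩ := hσ
  refine ⟨Q, a, fun w => z * u w, c, hQ, contDiffOn_const.mul hus, ?_, N, hN, hc, hcN,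
    fun s hs => ⟨(hγ s hs).1, by simp only [(hγ s hs).2, smul_smul]⟩⟩
  intro w hw v
  rw [((hus.hasFDerivAt hw).const_mul z).fderiv]
  have := hu w hw v
  simp only [smul_apply, smul_eq_mul]
  linear_combination z * this

/-- A unitary flat section on a small piece of the integral manifold is restricted to the path.
Nonvanishing allows it to be rescaled to any prescribed value in the line. -/
theorem exists_isParallelAt {hbar : ℝ} (hD : D.IsPrequantum Ω hbar) (γ : P.LeafSegment i)
    (t : unitInterval) : ∃ σ : ∀ t, L.fiber ⟨i, γ.toFun t⟩,
      D.IsParallelAt γ σ t ∧ ∀ᶠ s in 𝓝 t, σ s ≠ 0 := by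
  obtain ⟨Q, c, N, hN, hc, hcN, hγ⟩ := γ.leafwise t
  have ht := mem_of_mem_nhds hN
  obtain ⟨a, ha⟩ := L.O_cover i _ (γ.toFun t).2
  obtain ⟨O, hO, hOQ, u, hwO, -, hOa, hus, hu, hun⟩ :=
    D.exists_flatCoeff hD Q a (hcN ht) (by rwa [← hγ t ht])
  have hN' : N ∩ c ⁻¹' O ∈ 𝓝 t :=
    Filter.inter_mem hN ((hc.continuousAt hN).preimage_mem_nhds (hO.mem_nhds hwO))
  refine ⟨fun s => u (c s) • L.frame i a (γ.toFun s),
    ⟨Q.restrict O hO hOQ, a, u, c, hOa, hus, hu, _, hN', hc.mono Set.inter_subset_left,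
      fun s hs => hs.2, fun s hs => ⟨hγ s hs.1, rfl⟩⟩, ?_⟩
  filter_upwards [hN'] with s hs
  have hsa : (γ.toFun s : RSpace (2 * n)) ∈ L.O i a := by rw [hγ s hs.1]; exact hOa hs.2
  rw [← norm_ne_zero_iff, norm_smul, hun, L.norm_frame i a _ hsa]
  simp

theorem exists_smul_eq (L : OrbifoldLineBundle A) {p : A.Pt} {v : L.fiber p} (hv : v ≠ 0)
    (w : L.fiber p) : ∃ z : ℂ, z • v = w :=
  (finrank_eq_one_iff_of_nonzero' v hv).1 (L.finrank_eq p) w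

/-- Every leafwise path has a nowhere vanishing parallel lift. -/
theorem exists_isParallelLift (hP : P.IsReal) {hbar : ℝ} (hD : D.IsPrequantum Ω hbar)
    (γ : P.LeafSegment i) :
    ∃ σ : ∀ t, L.fiber ⟨i, γ.toFun t⟩, D.IsParallelLift γ σ ∧ σ 0 ≠ 0 := by
  classical
  set S : Set unitInterval := {t | ∃ σ : ∀ t, L.fiber ⟨i, γ.toFun t⟩,
    ∀ s ≤ t, D.IsParallelAt γ σ s ∧ σ s ≠ 0} with hS
  have hdown : ∀ s t, s ≤ t → t ∈ S → s ∈ S := by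
    rintro s t hst ⟨σ, hσ⟩
    exact ⟨σ, fun r hr => hσ r (hr.trans hst)⟩
  -- A neighbourhood that lies in `S` as soon as it meets `S` shows at once that `S` is open and
  -- closed.
  have hloc : ∀ t, ∃ N ∈ 𝓝 t, (N ∩ S).Nonempty → N ⊆ S := by
    intro t
    obtain ⟨τ, hτ, hτ0⟩ := exists_isParallelAt hD γ t
    obtain ⟨ε, hε, hball⟩ := Metric.eventually_nhds_iff_ball.1 (hτ.eventually.and hτ0)
    refine ⟨_, Metric.ball_mem_nhds t hε, ?_⟩
    rintro ⟨r, hrN, σ, hσ⟩ s hsN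
    rcases le_total s r with hsr | hrs
    · exact hdown s r hsr ⟨σ, hσ⟩
    obtain ⟨z, hz⟩ := exists_smul_eq L (hball r hrN).2 (σ r)
    have hz0 : z ≠ 0 := by
      rintro rfl
      rw [zero_smul] at hz
      exact (hσ r le_rfl).2 hz.symm
    have hmem : ∀ q, r ≤ q → q ≤ s → q ∈ Metric.ball t ε := by
      intro q hrq hqs
      rw [Metric.mem_ball, Subtype.dist_eq, Real.dist_eq, abs_lt] at hrN hsN ⊢
      have h1 : (r : ℝ) ≤ q := hrq
      have h2 : (q : ℝ) ≤ s := hqs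
      constructor <;> linarith [hrN.1, hsN.2]
    -- The old family is continued past `r` by the local one, scaled to agree at `r`. At the seam
    -- itself, local uniqueness makes both agree on a neighbourhood, so the glued family is parallel
    -- there.
    refine ⟨fun q => if q ≤ r then σ q else z • τ q, fun q hq => ?_⟩
    rcases lt_trichotomy q r with hqr | rfl | hqr
    · refine ⟨(hσ q hqr.le).1.congr ?_, by simpa [hqr.le] using (hσ q hqr.le).2⟩
      filter_upwards [Iio_mem_nhds hqr] with q' hq'
      rw [if_pos (le_of_lt hq')]
    · refine ⟨(hσ q le_rfl).1.congr ?_, by simpa using (hσ q le_rfl).2⟩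
      filter_upwards [(hσ q le_rfl).1.eventually_eq hP ((hball q hrN).1.smul z) hz.symm] with q' hq'
      split_ifs
      · rfl
      · exact hq'.symm
    · have hqN := hmem q hqr.le hq
      refine ⟨((hball q hqN).1.smul z).congr ?_, ?_⟩
      · filter_upwards [Ioi_mem_nhds hqr] with q' hq'
        rw [if_neg (not_le.2 hq')]
      · simp only [if_neg (not_le.2 hqr)]
        exact smul_ne_zero hz0 (hball q hqN).2
  have hclopen : IsClopen S := by
    constructor
    · rw [← isOpen_compl_iff, isOpen_iff_mem_nhds]
      intro t ht
      obtain ⟨N, hN, h⟩ := hloc t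
      refine Filter.mem_of_superset hN fun s hs hsS => ht ?_
      exact h ⟨s, hs, hsS⟩ (mem_of_mem_nhds hN)
    · rw [isOpen_iff_mem_nhds]
      intro t ht
      obtain ⟨N, hN, h⟩ := hloc t
      exact Filter.mem_of_superset hN (h ⟨t, mem_of_mem_nhds hN, ht⟩)
  have h0 : (0 : unitInterval) ∈ S := by
    obtain ⟨τ, hτ, hτ0⟩ := exists_isParallelAt hD γ 0
    refine ⟨τ, fun s hs => ?_⟩
    obtain rfl : s = 0 := le_antisymm hs unitInterval.nonneg'
    exact ⟨hτ, hτ0.self_of_nhds⟩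
  obtain ⟨σ, hσ⟩ : (1 : unitInterval) ∈ S := (hclopen.eq_univ ⟨0, h0⟩) ▸ Set.mem_univ 1
  exact ⟨σ, fun t => (hσ t unitInterval.le_one').1, (hσ 0 unitInterval.nonneg').2⟩

/-- Parallel transport along a leafwise path exists, is unique, and is a linear isometry. -/
theorem exists_transport (hP : P.IsReal) {hbar : ℝ} (hD : D.IsPrequantum Ω hbar)
    (γ : P.LeafSegment i) :
    ∃ T : L.fiber ⟨i, γ.toFun 0⟩ ≃ₗᵢ[ℂ] L.fiber ⟨i, γ.toFun 1⟩,
      D.par γ = T ∧ ∀ v w, D.IsTransport γ v w ↔ T v = w := by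
  obtain ⟨σ, hσ, hσ0⟩ := exists_isParallelLift hP hD γ
  have hinner : Inner.inner ℂ (σ 1) (σ 1) = Inner.inner ℂ (σ 0) (σ 0) := hσ.inner_eq hP hσ 1 0
  have hself : Inner.inner ℂ (σ 0) (σ 0) ≠ 0 := inner_self_ne_zero.2 hσ0
  -- The map `z σ(0) ↦ z σ(1)`, with the coordinate `z` read off by pairing with `σ(0)`.
  set T₀ : L.fiber ⟨i, γ.toFun 0⟩ →ₗ[ℂ] L.fiber ⟨i, γ.toFun 1⟩ :=
    (LinearMap.toSpanSingleton ℂ _ (σ 1)).comp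
      ((Inner.inner ℂ (σ 0) (σ 0))⁻¹ • (innerSL ℂ (σ 0)).toLinearMap) with hT₀
  have hT₀z : ∀ z : ℂ, T₀ (z • σ 0) = z • σ 1 := by
    intro z
    simp only [hT₀, LinearMap.comp_apply, LinearMap.smul_apply, ContinuousLinearMap.coe_coe,
      innerSL_apply_apply, inner_smul_right, smul_eq_mul, LinearMap.toSpanSingleton_apply]
    congr 1
    field_simp
  have hinn : ∀ v w, Inner.inner ℂ (T₀ v) (T₀ w) = Inner.inner ℂ v w := by
    intro v w
    obtain ⟨y, rfl⟩ := exists_smul_eq L hσ0 v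
    obtain ⟨z, rfl⟩ := exists_smul_eq L hσ0 w
    simp only [hT₀z, inner_smul_left, inner_smul_right, hinner]
  have : FiniteDimensional ℂ (L.fiber ⟨i, γ.toFun 0⟩) :=
    FiniteDimensional.of_finrank_pos (by rw [L.finrank_eq]; exact one_pos)
  have : FiniteDimensional ℂ (L.fiber ⟨i, γ.toFun 1⟩) :=
    FiniteDimensional.of_finrank_pos (by rw [L.finrank_eq]; exact one_pos)
  set T := (T₀.isometryOfInner hinn).toLinearIsometryEquiv
    ((L.finrank_eq _).trans (L.finrank_eq _).symm)
  have hTz : ∀ z : ℂ, T (z • σ 0) = z • σ 1 := hT₀z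
  have hiff : ∀ v w, D.IsTransport γ v w ↔ T v = w := by
    intro v w
    obtain ⟨z, rfl⟩ := exists_smul_eq L hσ0 v
    have hz : D.IsParallelLift γ fun s => z • σ s := fun t => IsParallelAt.smul (hσ t) z
    rw [hTz]
    constructor
    · rintro ⟨τ, hτ, h0, h1⟩
      rw [← h1]
      exact hz.eq hP hτ h0.symm 1
    · rintro rfl
      exact ⟨_, hz, rfl, rfl⟩
  refine ⟨T, funext fun v => ?_, hiff⟩
  exact ((hiff v _).1 (Classical.epsilon_spec ⟨T v, (hiff v _).2 rfl⟩)).symm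

/-- Transport along the restriction of a parallel lift. -/
theorem IsParallelLift.par_eq (hP : P.IsReal) {hbar : ℝ} (hD : D.IsPrequantum Ω hbar)
    {σ : ∀ t, L.fiber ⟨i, γ.toFun t⟩} (hσ : D.IsParallelLift γ σ) : D.par γ (σ 0) = σ 1 := by
  obtain ⟨T, hT, hiff⟩ := exists_transport hP hD γ
  rw [hT]
  exact (hiff _ _).1 ⟨σ, hσ, rfl, rfl⟩

end UnitaryConnection

end OrbifoldLineBundle

end

/-! ### Leafwise orbifold paths, holonomy and parallel sections -/

noncomputable section

namespace OrbifoldPolarization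

variable {n : ℕ} {X : Type*} [TopologicalSpace X] {A : OrbifoldAtlas (2 * n) X}
  {Ω : OrbifoldSymplecticForm A} {P : OrbifoldPolarization Ω}

/-- Points over the same point of `X` are joined by transitions. -/
theorem nonempty_leafPath_of_proj_eq (P : OrbifoldPolarization Ω) {p q : A.Pt}
    (h : A.proj p = A.proj q) : Nonempty (P.LeafPath p q) := by
  obtain ⟨i, x⟩ := p
  obtain ⟨j, y⟩ := q
  have h' : (A.chart i).proj x = (A.chart j).proj y := h
  obtain ⟨k, ⟨z, hz, hzx⟩, -, ⟨e⟩, ⟨e'⟩⟩ := A.compat i j ((A.chart i).proj x)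
    ⟨⟨x, x.2, rfl⟩, ⟨y, y.2, h'.symm⟩⟩
  -- The images of `z` in the two charts only lie in the orbits of `x` and `y`; local group elements
  -- correct them.
  obtain ⟨g, hg⟩ := ((A.chart i).proj_eq_iff _ (e.mapsTo hz) _ x.2).1
    ((e.proj_comp z hz).trans hzx)
  obtain ⟨g', hg'⟩ := ((A.chart j).proj_eq_iff _ (e'.mapsTo hz) _ y.2).1
    ((e'.proj_comp z hz).trans (hzx.trans h'))
  exact ⟨.trans (.jumpInv ((A.chart i).autEmb g) ⟨_, e.mapsTo hz⟩ x hg)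
    (.trans (.jumpInv e ⟨z, hz⟩ ⟨_, e.mapsTo hz⟩ rfl)
      (.trans (.jump e' ⟨z, hz⟩ ⟨_, e'.mapsTo hz⟩ rfl)
        (.jump ((A.chart j).autEmb g') ⟨_, e'.mapsTo hz⟩ y hg')))⟩

/-- A leaf has a base point from which exactly the points over the leaf can be reached. -/
theorem IsLeaf.exists_base {Λ : Set X} (hΛ : P.IsLeaf Λ) :
    ∃ p : A.Pt, ∀ q : A.Pt, A.proj q ∈ Λ ↔ Nonempty (P.LeafPath p q) := by
  obtain ⟨p, rfl⟩ := hΛ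
  refine ⟨p, fun q => ⟨?_, fun h => ⟨q, rfl, h⟩⟩⟩
  rintro ⟨q', hq', ⟨ℓ⟩⟩
  obtain ⟨ℓ'⟩ := P.nonempty_leafPath_of_proj_eq hq'
  exact ⟨ℓ.trans ℓ'⟩

theorem IsLeaf.proj_mem {Λ : Set X} (hΛ : P.IsLeaf Λ) {p q : A.Pt} (ℓ : P.LeafPath p q)
    (hp : A.proj p ∈ Λ) : A.proj q ∈ Λ := by
  obtain ⟨p₀, h⟩ := hΛ.exists_base
  obtain ⟨ℓ₀⟩ := (h p).1 hp
  exact (h q).2 ⟨ℓ₀.trans ℓ⟩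

/-- Reparametrization of a leafwise path. -/
def LeafSegment.comp {i : A.Idx} (γ : P.LeafSegment i) (φ : C(unitInterval, unitInterval)) :
    P.LeafSegment i where
  toFun := fun t => γ.toFun (φ t)
  leafwise := fun t => by
    obtain ⟨Q, c, N, hN, hc, hcN, hγ⟩ := γ.leafwise (φ t)
    exact ⟨Q, c ∘ φ, φ ⁻¹' N, φ.continuous.continuousAt.preimage_mem_nhds hN,
      hc.comp φ.continuous.continuousOn fun _ hs => hs, fun s hs => hcN hs, fun s hs => hγ _ hs⟩

/-- The image of a line segment in the parameter domain of an integral manifold. -/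
def Plaque.line {i : A.Idx} (Q : P.Plaque i) (hQ : Convex ℝ Q.dom) {w₀ w₁ : RSpace n}
    (h₀ : w₀ ∈ Q.dom) (h₁ : w₁ ∈ Q.dom) : P.LeafSegment i where
  toFun := fun t => Q.pt (AffineMap.lineMap w₀ w₁ (t : ℝ)) (hQ.lineMap_mem h₀ h₁ t.2)
  leafwise := fun _ => ⟨Q, fun t => AffineMap.lineMap w₀ w₁ (t : ℝ), Set.univ, Filter.univ_mem,
    (AffineMap.lineMap_continuous.comp continuous_subtype_val).continuousOn,
    fun s _ => hQ.lineMap_mem h₀ h₁ s.2, fun _ _ => rfl⟩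

theorem LeafSegment.nonempty_leafPath {i : A.Idx} (γ : P.LeafSegment i) (t : unitInterval) :
    Nonempty (P.LeafPath ⟨i, γ.toFun 0⟩ ⟨i, γ.toFun t⟩) := by
  let γ' := γ.comp ⟨fun s => s * t, by fun_prop⟩
  have h0 : γ'.toFun 0 = γ.toFun 0 := congrArg γ.toFun (zero_mul t)
  have h1 : γ'.toFun 1 = γ.toFun t := congrArg γ.toFun (one_mul t)
  rw [← h0, ← h1]
  exact ⟨.segment γ'⟩

end OrbifoldPolarization

namespace OrbifoldLineBundle

variable {n : ℕ} {X : Type*} [TopologicalSpace X] {A : OrbifoldAtlas (2 * n) X}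
  {Ω : OrbifoldSymplecticForm A} {L : OrbifoldLineBundle A} {P : OrbifoldPolarization Ω}

namespace UnitaryConnection

variable {D : L.UnitaryConnection} {i : A.Idx}

/-- Transport along a leafwise path between points given up to equality. -/
theorem exists_leafPath_of_segment (hP : P.IsReal) {hbar : ℝ} (hD : D.IsPrequantum Ω hbar)
    (γ : P.LeafSegment i) {x y : A.V i} (hx : γ.toFun 0 = x) (hy : γ.toFun 1 = y) :
    ∃ ℓ : P.LeafPath ⟨i, x⟩ ⟨i, y⟩, ∀ σ : ∀ t, L.fiber ⟨i, γ.toFun t⟩, D.IsParallelLift γ σ →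
      ∀ v w, HEq (σ 0) v → HEq (σ 1) w → D.hol ℓ v = w := by
  -- Endpoints of reversed or straight paths agree with the wanted points only up to a proved
  -- equality, so fibre vectors are compared by `HEq` until the equalities are substituted.
  subst hx hy
  refine ⟨.segment γ, fun σ hσ v w hv hw => ?_⟩
  obtain rfl := eq_of_heq hv
  obtain rfl := eq_of_heq hw
  simp only [hol]
  exact hσ.par_eq hP hD

theorem IsParallelLift.comp {γ : P.LeafSegment i} {σ : ∀ t, L.fiber ⟨i, γ.toFun t⟩}
    (hσ : D.IsParallelLift γ σ) (φ : C(unitInterval, unitInterval)) :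
    D.IsParallelLift (γ.comp φ) fun t => σ (φ t) := fun t => by
  obtain ⟨Q, a, u, c, hQ, hus, hu, N, hN, hc, hcN, hγ⟩ := hσ (φ t)
  exact ⟨Q, a, u, c ∘ φ, hQ, hus, hu, φ ⁻¹' N, φ.continuous.continuousAt.preimage_mem_nhds hN,
    hc.comp φ.continuous.continuousOn fun _ hs => hs, fun s hs => hcN hs, fun s hs => hγ _ hs⟩

/-- Transport along a leafwise orbifold path is a linear isometry. -/
theorem exists_hol_eq (hP : P.IsReal) {hbar : ℝ} (hD : D.IsPrequantum Ω hbar) {p q : A.Pt}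
    (ℓ : P.LeafPath p q) : ∃ T : L.fiber p ≃ₗᵢ[ℂ] L.fiber q, D.hol ℓ = T := by
  induction ℓ with
  | refl p => exact ⟨LinearIsometryEquiv.refl ℂ _, by simp only [hol]; rfl⟩
  | segment γ =>
    obtain ⟨T, hT, -⟩ := exists_transport (L := L) hP hD γ
    exact ⟨T, by simp only [hol]; exact hT⟩
  | jump e x y h => exact ⟨L.trans e x y h, by simp only [hol]⟩
  | jumpInv e x y h => exact ⟨(L.trans e x y h).symm, by simp only [hol]⟩
  | trans ℓ₁ ℓ₂ ih₁ ih₂ =>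
    obtain ⟨T₁, h₁⟩ := ih₁
    obtain ⟨T₂, h₂⟩ := ih₂
    exact ⟨T₁.trans T₂, by simp only [hol, h₁, h₂]; rfl⟩

/-- Leafwise orbifold paths can be reversed, with inverse transport. -/
theorem exists_reverse (hP : P.IsReal) {hbar : ℝ} (hD : D.IsPrequantum Ω hbar) {p q : A.Pt}
    (ℓ : P.LeafPath p q) : ∃ ℓ' : P.LeafPath q p, ∀ v, D.hol ℓ' (D.hol ℓ v) = v := by
  induction ℓ with
  | refl p => exact ⟨.refl p, fun v => by simp [hol]⟩
  | segment γ =>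
    have e0 : unitInterval.symm 0 = 1 := unitInterval.symm_zero
    have e1 : unitInterval.symm 1 = 0 := unitInterval.symm_one
    obtain ⟨ℓ', hℓ'⟩ := exists_leafPath_of_segment (D := D) hP hD
      (γ.comp ⟨unitInterval.symm, unitInterval.continuous_symm⟩)
      (congrArg γ.toFun e0) (congrArg γ.toFun e1)
    refine ⟨ℓ', fun v => ?_⟩
    obtain ⟨T, hT, hiff⟩ := exists_transport (L := L) (D := D) hP hD γ
    obtain ⟨σ, hσ, rfl, h1⟩ := (hiff v (T v)).2 rfl
    simp only [hol, hT]
    rw [← h1]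
    exact hℓ' _ (hσ.comp _) _ _ (congr_arg_heq σ e0) (congr_arg_heq σ e1)
  | jump e x y h => exact ⟨.jumpInv e x y h, fun v => by simp [hol]⟩
  | jumpInv e x y h => exact ⟨.jump e x y h, fun v => by simp [hol]⟩
  | trans ℓ₁ ℓ₂ ih₁ ih₂ =>
    obtain ⟨ℓ₁', h₁⟩ := ih₁
    obtain ⟨ℓ₂', h₂⟩ := ih₂
    exact ⟨.trans ℓ₂' ℓ₁', fun v => by simp [hol, h₁, h₂]⟩

/-- Transport within an integral manifold with convex parameter domain. -/
theorem exists_leafPath_plaque (hP : P.IsReal) {hbar : ℝ} (hD : D.IsPrequantum Ω hbar)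
    (Q : P.Plaque i) (hQ : Convex ℝ Q.dom) {w₀ w₁ : RSpace n} (h₀ : w₀ ∈ Q.dom)
    (h₁ : w₁ ∈ Q.dom) :
    ∃ ℓ : P.LeafPath ⟨i, Q.pt w₀ h₀⟩ ⟨i, Q.pt w₁ h₁⟩, ∀ (a : L.Frame i) (u : RSpace n → ℂ),
      Set.MapsTo Q.toFun Q.dom (L.O i a) → IsSmoothCoeff Q u → D.IsFlatCoeff Q a u →
      D.hol ℓ (u w₀ • L.frame i a (Q.pt w₀ h₀)) = u w₁ • L.frame i a (Q.pt w₁ h₁) := by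
  have hx : (Q.line hQ h₀ h₁).toFun 0 = Q.pt w₀ h₀ := by
    simp [OrbifoldPolarization.Plaque.line, OrbifoldPolarization.Plaque.pt]
  have hy : (Q.line hQ h₀ h₁).toFun 1 = Q.pt w₁ h₁ := by
    simp [OrbifoldPolarization.Plaque.line, OrbifoldPolarization.Plaque.pt]
  obtain ⟨ℓ, hℓ⟩ := exists_leafPath_of_segment (D := D) hP hD (Q.line hQ h₀ h₁) hx hy
  refine ⟨ℓ, fun a u hQa hus hu => hℓ (fun t => u (AffineMap.lineMap w₀ w₁ (t : ℝ)) •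
    L.frame i a ((Q.line hQ h₀ h₁).toFun t)) (fun t => ?_) _ _ ?_ ?_⟩
  · exact ⟨Q, a, u, fun t => AffineMap.lineMap w₀ w₁ (t : ℝ), hQa, hus, hu, Set.univ,
      Filter.univ_mem, (AffineMap.lineMap_continuous.comp continuous_subtype_val).continuousOn,
      fun s _ => hQ.lineMap_mem h₀ h₁ s.2, fun _ _ => ⟨rfl, rfl⟩⟩
  · rw [hx]; simp
  · rw [hy]; simp

/-- A covariantly constant section along a leaf is preserved by transport. -/
theorem IsCovariantlyConstant.hol_val (hP : P.IsReal) {hbar : ℝ} (hD : D.IsPrequantum Ω hbar)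
    {Λ : Set X} (hΛ : P.IsLeaf Λ) {s : LeafSection L P Λ} (hs : D.IsCovariantlyConstant s)
    {p q : A.Pt} (ℓ : P.LeafPath p q) (hp : A.proj p ∈ Λ) (hq : A.proj q ∈ Λ) :
    D.hol ℓ (s.val p hp) = s.val q hq := by
  induction ℓ with
  | refl p => simp [hol]
  | @segment i γ =>
    have hmem : ∀ t, A.proj ⟨i, γ.toFun t⟩ ∈ Λ := fun t => by
      obtain ⟨ℓ⟩ := γ.nonempty_leafPath t
      exact hΛ.proj_mem ℓ hp
    simp only [hol]
    have hlift : D.IsParallelLift γ fun t => s.val ⟨i, γ.toFun t⟩ (hmem t) := fun t => by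
      obtain ⟨Q, c, N, hN, hc, hcN, hγ⟩ := γ.leafwise t
      have ht := mem_of_mem_nhds hN
      obtain ⟨a, ha⟩ := L.O_cover i _ (γ.toFun t).2
      -- A convex parameter domain joins each of its points to that of `γ t` by a straight leafwise
      -- path, so the whole piece lies over `Λ` and smoothness of the section can be used on it.
      obtain ⟨O, hO, hOQ, -, hwO, hOc, hOa, -⟩ :=
        D.exists_flatCoeff hD Q a (hcN ht) (by rwa [← hγ t ht])
      have hpt : (Q.restrict O hO hOQ).pt (c t) hwO = γ.toFun t := Subtype.ext (hγ t ht).symm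
      have hQΛ : ∀ w hw, A.proj ⟨i, (Q.restrict O hO hOQ).pt w hw⟩ ∈ Λ := fun w hw => by
        obtain ⟨ℓ, -⟩ := exists_leafPath_plaque (D := D) hP hD (Q.restrict O hO hOQ) hOc hwO hw
        exact hΛ.proj_mem ℓ (by rw [hpt]; exact hmem t)
      obtain ⟨u, hus, hu⟩ := s.smooth _ hQΛ a hOa
      refine ⟨Q.restrict O hO hOQ, a, u, c, hOa, hus, hs _ hQΛ a u hOa hus hu, N ∩ c ⁻¹' O,
        Filter.inter_mem hN ((hc.continuousAt hN).preimage_mem_nhds (hO.mem_nhds hwO)),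
        hc.mono Set.inter_subset_left, fun r hr => hr.2, fun r hr => ⟨hγ r hr.1, ?_⟩⟩
      have hpr : (Q.restrict O hO hOQ).pt (c r) hr.2 = γ.toFun r :=
        Subtype.ext (hγ r hr.1).symm
      have key : ∀ (x : A.V i) (hx : A.proj ⟨i, x⟩ ∈ Λ),
          (Q.restrict O hO hOQ).pt (c r) hr.2 = x →
          s.val ⟨i, x⟩ hx = u (c r) • L.frame i a x := by
        rintro x hx rfl
        exact hu _ _
      exact key _ _ hpr
    exact hlift.par_eq hP hD
  | jump e x y h => simp only [hol]; exact s.equivariant e x y h hp hq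
  | jumpInv e x y h =>
    simp only [hol]
    rw [← s.equivariant e x y h hq hp, LinearIsometryEquiv.symm_apply_apply]
  | trans ℓ₁ ℓ₂ ih₁ ih₂ =>
    have hm := hΛ.proj_mem ℓ₁ hp
    simp only [hol, Function.comp_apply]
    rw [ih₁ hp hm, ih₂ hm hq]

/-- Transport is injective and carries the section to itself, so its value at `p` is nonzero. The
holonomy fixes this vector, which spans the fibre. -/
theorem IsBohrSommerfeld.hol_eq_id (hP : P.IsReal) {hbar : ℝ} (hD : D.IsPrequantum Ω hbar)
    {Λ : Set X} (hΛ : P.IsLeaf Λ) (h : D.IsBohrSommerfeld P Λ) {p : A.Pt} (hp : A.proj p ∈ Λ)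
    (ℓ : P.LeafPath p p) : D.hol ℓ = id := by
  obtain ⟨s, hs, q, hq, hne⟩ := h
  obtain ⟨p₀, hp₀⟩ := hΛ.exists_base
  obtain ⟨ℓp⟩ := (hp₀ p).1 hp
  obtain ⟨ℓq⟩ := (hp₀ q).1 hq
  obtain ⟨ℓq', -⟩ := exists_reverse (D := D) hP hD ℓq
  have hqp := hs.hol_val hP hD hΛ (ℓq'.trans ℓp) hq hp
  obtain ⟨T, hT⟩ := exists_hol_eq (D := D) hP hD (ℓq'.trans ℓp)
  have hpne : s.val p hp ≠ 0 := by
    rw [← hqp, hT]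
    simpa using hne
  have hfix := hs.hol_val hP hD hΛ ℓ hp hp
  obtain ⟨T', hT'⟩ := exists_hol_eq (D := D) hP hD ℓ
  funext v
  obtain ⟨z, rfl⟩ := exists_smul_eq L hpne v
  rw [hT'] at hfix ⊢
  rw [map_smul, hfix, id]

/-- If the values of `val` over a leaf are related by transport, they are locally given along
integral manifolds by smooth covariantly constant sections. -/
theorem exists_local_coeff (hP : P.IsReal) {hbar : ℝ} (hD : D.IsPrequantum Ω hbar) {Λ : Set X}
    {val : ∀ p : A.Pt, A.proj p ∈ Λ → L.fiber p}
    (hval : ∀ {p q : A.Pt} (ℓ : P.LeafPath p q) (hp : A.proj p ∈ Λ) (hq : A.proj q ∈ Λ),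
      D.hol ℓ (val p hp) = val q hq)
    (Q : P.Plaque i) (hQ : ∀ w hw, A.proj ⟨i, Q.pt w hw⟩ ∈ Λ) (a : L.Frame i)
    (hQa : Set.MapsTo Q.toFun Q.dom (L.O i a)) {w₀ : RSpace n} (hw₀ : w₀ ∈ Q.dom) :
    ∃ (O : Set (RSpace n)) (hO : IsOpen O) (hOQ : O ⊆ Q.dom) (u : RSpace n → ℂ), w₀ ∈ O ∧
      IsSmoothCoeff (Q.restrict O hO hOQ) u ∧ D.IsFlatCoeff (Q.restrict O hO hOQ) a u ∧
      ∀ w ∈ O, ∀ hw, val ⟨i, Q.pt w hw⟩ (hQ w hw) = u w • L.frame i a (Q.pt w hw) := by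
  obtain ⟨O, hO, hOQ, u, hwO, hOc, hOa, hus, hu, hun⟩ :=
    D.exists_flatCoeff hD Q a hw₀ (hQa hw₀)
  have hne : u w₀ • L.frame i a (Q.pt w₀ hw₀) ≠ 0 := by
    rw [← norm_ne_zero_iff, norm_smul, hun, L.norm_frame i a _ (hQa hw₀)]
    simp
  -- The scalar matches the local flat section with `val` at `w₀`; transport along the straight line
  -- to `w` carries both, so they agree throughout `O`.
  obtain ⟨z, hz⟩ := exists_smul_eq L hne (val ⟨i, Q.pt w₀ hw₀⟩ (hQ w₀ hw₀))
  have hus' : IsSmoothCoeff (Q.restrict O hO hOQ) fun w => z * u w := contDiffOn_const.mul hus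
  have hu' : D.IsFlatCoeff (Q.restrict O hO hOQ) a fun w => z * u w := by
    intro w hw v
    rw [((hus.hasFDerivAt hw).const_mul z).fderiv]
    have := hu w hw v
    simp only [smul_apply, smul_eq_mul]
    linear_combination z * this
  refine ⟨O, hO, hOQ, fun w => z * u w, hwO, hus', hu', fun w hwO' hw => ?_⟩
  obtain ⟨ℓ, hℓ⟩ := exists_leafPath_plaque (D := D) hP hD (Q.restrict O hO hOQ) hOc hwO hwO'
  have h1 := hℓ a _ hOa hus' hu'
  have h2 := hval ℓ (hQ w₀ hw₀) (hQ w hw)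
  have hz' : (z * u w₀) • L.frame i a (Q.pt w₀ hw₀) = val ⟨i, Q.pt w₀ hw₀⟩ (hQ w₀ hw₀) := by
    rw [← hz, smul_smul]
  exact h2.symm.trans ((congrArg (D.hol ℓ) hz'.symm).trans h1)

/-- A leaf with trivial orbifold holonomy is Bohr-Sommerfeld. -/
theorem isBohrSommerfeld_of_hol_eq_id (hP : P.IsReal) {hbar : ℝ} (hD : D.IsPrequantum Ω hbar)
    {Λ : Set X} (hΛ : P.IsLeaf Λ)
    (h : ∀ p : A.Pt, A.proj p ∈ Λ → ∀ ℓ : P.LeafPath p p, D.hol ℓ = id) :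
    D.IsBohrSommerfeld P Λ := by
  classical
  obtain ⟨p₀, hp₀⟩ := hΛ.exists_base
  have hp₀Λ : A.proj p₀ ∈ Λ := (hp₀ p₀).2 ⟨.refl p₀⟩
  have : Nontrivial (L.fiber p₀) :=
    Module.nontrivial_of_finrank_pos (R := ℂ) (by rw [L.finrank_eq]; exact one_pos)
  obtain ⟨v₀, hv₀⟩ := exists_ne (0 : L.fiber p₀)
  let val : ∀ p : A.Pt, A.proj p ∈ Λ → L.fiber p := fun p hp => D.hol ((hp₀ p).1 hp).some v₀
  -- Path-independence: `ℓ` followed by the reverse of the chosen path is a loop at `p₀`, whose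
  -- holonomy is trivial.
  have hbase : ∀ (p : A.Pt) (hp : A.proj p ∈ Λ) (ℓ : P.LeafPath p₀ p), D.hol ℓ v₀ = val p hp := by
    intro p hp ℓ
    obtain ⟨ℓ', hℓ'⟩ := exists_reverse (D := D) hP hD ((hp₀ p).1 hp).some
    obtain ⟨T, hT⟩ := exists_hol_eq (D := D) hP hD ℓ'
    have h1 := congrFun (h p₀ hp₀Λ (ℓ.trans ℓ')) v₀
    simp only [hol, Function.comp_apply, id] at h1
    have h2 := h1.trans (hℓ' v₀).symm
    rw [hT] at h2
    exact T.injective h2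
  have hval : ∀ {p q : A.Pt} (ℓ : P.LeafPath p q) (hp : A.proj p ∈ Λ) (hq : A.proj q ∈ Λ),
      D.hol ℓ (val p hp) = val q hq := by
    intro p q ℓ hp hq
    rw [← hbase q hq (((hp₀ p).1 hp).some.trans ℓ)]
    simp only [hol, Function.comp_apply, val]
  refine ⟨⟨val, ?_, ?_⟩, ?_, p₀, hp₀Λ, ?_⟩
  · intro k i e x y hxy hx hy
    have := hval (.jump e x y hxy) hx hy
    simpa only [hol] using this
  · intro i Q hQ a hQa
    -- The coefficient is chosen point by point, with 0 outside the domain. Since the frame does not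
    -- vanish, the choice is forced inside and agrees near each point with a smooth local
    -- coefficient.
    have hex : ∀ w, ∃ z : ℂ, ∀ hw : w ∈ Q.dom,
        val ⟨i, Q.pt w hw⟩ (hQ w hw) = z • L.frame i a (Q.pt w hw) := by
      intro w
      by_cases hw : w ∈ Q.dom
      · obtain ⟨O, hO, hOQ, u, hwO, -, -, hu⟩ := exists_local_coeff hP hD hval Q hQ a hQa hw
        exact ⟨u w, hu w hwO⟩
      · exact ⟨0, fun hw' => absurd hw' hw⟩
    choose u hu using hex
    refine ⟨u, fun w hw => ContDiffAt.contDiffWithinAt ?_, hu⟩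
    obtain ⟨O, hO, hOQ, u', hwO, hus', -, hu'⟩ := exists_local_coeff hP hD hval Q hQ a hQa hw
    refine (ContDiffOn.contDiffAt hus' (hO.mem_nhds hwO)).congr_of_eventuallyEq ?_
    filter_upwards [hO.mem_nhds hwO] with r hr
    have hne : L.frame i a (Q.pt r (hOQ hr)) ≠ 0 := by
      rw [← norm_ne_zero_iff, L.norm_frame i a _ (hQa (hOQ hr))]; exact one_ne_zero
    exact smul_left_injective ℂ hne ((hu r (hOQ hr)).symm.trans (hu' r hr (hOQ hr)))
  · intro i Q hQ a u hQa _ hu w hw v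
    obtain ⟨O, hO, hOQ, u', hwO, -, huf', hu'⟩ := exists_local_coeff hP hD hval Q hQ a hQa hw
    have hev : u =ᶠ[𝓝 w] u' := by
      filter_upwards [hO.mem_nhds hwO] with r hr
      have hne : L.frame i a (Q.pt r (hOQ hr)) ≠ 0 := by
        rw [← norm_ne_zero_iff, L.norm_frame i a _ (hQa (hOQ hr))]; exact one_ne_zero
      exact smul_left_injective ℂ hne ((hu r (hOQ hr)).symm.trans (hu' r hr (hOQ hr)))
    rw [hev.fderiv_eq, hev.self_of_nhds]
    exact huf' w hwO v
  · change val p₀ hp₀Λ ≠ 0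
    rw [← hbase p₀ hp₀Λ (.refl p₀)]
    simpa only [hol, id] using hv₀

end UnitaryConnection

end OrbifoldLineBundle

end

theorem mainTheorem5 {n : ℕ} {X : Type*} [TopologicalSpace X] [T2Space X] [ParacompactSpace X]
    (A : OrbifoldAtlas (2 * n) X) (Ω : OrbifoldSymplecticForm A)
    (P : OrbifoldPolarization Ω) (hP : P.IsReal)
    (L : OrbifoldLineBundle A) (D : L.UnitaryConnection)
    (hbar : ℝ) (hbar_pos : 0 < hbar) (hD : D.IsPrequantum Ω hbar)
    (Λ : Set X) (hΛ : P.IsLeaf Λ) :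
    -- leafwise parallel transport exists, is unique, and is a linear isometry
    (∀ (i : A.Idx) (γ : P.LeafSegment i),
      ∃ T : L.fiber ⟨i, γ.toFun 0⟩ ≃ₗᵢ[ℂ] L.fiber ⟨i, γ.toFun 1⟩,
        D.par γ = T ∧ ∀ v w, D.IsTransport γ v w ↔ T v = w) ∧
    -- Bohr-Sommerfeld if and only if all leafwise orbifold holonomies are trivial
    (D.IsBohrSommerfeld P Λ ↔
      ∀ p : A.Pt, A.proj p ∈ Λ → ∀ ℓ : P.LeafPath p p, D.hol ℓ = id) ∧
    -- the form of the condition for a loop represented in a single chart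
    (∀ (i : A.Idx) (γ : P.LeafSegment i) (g : (A.chart i).G)
      (hg : (A.chart i).act g (γ.toFun 0) = γ.toFun 1),
      D.hol (P.chartLoop γ g hg) = id ↔
        ∀ v, L.Φ g⁻¹ (γ.toFun 1) (γ.toFun 0)
          ((A.chart i).act_inv_eq g (γ.toFun 0).2 hg) (D.par γ v) = v) := by
  refine ⟨fun i γ => OrbifoldLineBundle.UnitaryConnection.exists_transport hP hD γ,
    ⟨fun h p hp ℓ => h.hol_eq_id hP hD hΛ hp ℓ,
      OrbifoldLineBundle.UnitaryConnection.isBohrSommerfeld_of_hol_eq_id hP hD hΛ⟩, ?_⟩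
  intro i γ g hg
  -- The loop is the segment followed by the jump along `g⁻¹`, and `Φ` is the bundle map over that
  -- jump, so both sides agree by unfolding.
  rw [funext_iff]
  simp only [OrbifoldPolarization.chartLoop, OrbifoldLineBundle.UnitaryConnection.hol,
    Function.comp_apply, id]
  exact Iff.rfl
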